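/- Let $\mathcal O_n=\mathbb C\{x_1,\dots,x_n\}$ be the ring of convergent power series, with maximal ideal $\mathfrak m$. Call $f,g\in\mathcal O_n$ right equivalent if $\varphi(f)=g$ for some $\mathbb C$-algebra automorphism $\varphi$ of $\mathcal O_n$, and call $f$ right $k$-determined if every $g\in\mathcal O_n$ with the same image as $f$ in $\mathcal O_n/\mathfrak m^{k+1}$ is right equivalent to $f$. Call the germs $\{f=0\}$ and $\{g=0\}$ at the origin analytically equivalent if some $\mathbb C$-algebra automorphism of $\mathcal O_n$ maps the ideal $(f)$ onto the ideal $(g)$. A homogeneous polynomial $f\in\mathbb C[x_1,\dots,x_n]$ is regular if the hypersurface $\{f=0\}\subset\mathbb P^{n-1}$ is smooth, i.e. at each of its points some partial derivative of $f$ does not vanish. Let $D(n,m)$ be the least integer $D>m$ such that, for every regular homogeneous polynomial $f$ of degree $m$ in $n$ variables, every $d\ge D$ and every $g\in\mathcal O_n$ such that $g-f$ has order at least $d$, the germs $\{g=0\}$ and $\{f=0\}$ at the origin are analytically equivalent. Theorem. Let $n\ge 2$ and $m\ge 3$ be integers with $(n,m)\neq(2,3)$. Then every regular homogeneous polynomial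 $f$ of degree $m$ in $n$ variables is right $n(m-2)$-determined. Consequently $D(n,m)$ exists, $D(n,m)\le n(m-2)+1$, and $D(n,m)=m+1$ for $(n,m)=(3,3)$ and for $(n,m)=(2,4)$. -/

import Mathlib

namespace ConvergentSeries

/-- A formal power series in `n` complex variables is convergent if it converges absolutely on
some polydisc of positive radius around the origin. -/
def IsConvergent {n : ℕ} (f : MvPowerSeries (Fin n) ℂ) : Prop :=
  ∃ r : ℝ, 0 < r ∧ Summable fun a : Fin n →₀ ℕ => ‖MvPowerSeries.coeff a f‖ * r ^ a.degree

theorem IsConvergent.mono {n : ℕ} {f : MvPowerSeries (Fin n) ℂ} {r s : ℝ} (hs : 0 < s)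
    (hsr : s ≤ r)
    (h : Summable fun a : Fin n →₀ ℕ => ‖MvPowerSeries.coeff a f‖ * r ^ a.degree) :
    Summable fun a : Fin n →₀ ℕ => ‖MvPowerSeries.coeff a f‖ * s ^ a.degree :=
  Summable.of_nonneg_of_le (fun a => by positivity) (fun a => by gcongr) h

theorem IsConvergent.add {n : ℕ} {f g : MvPowerSeries (Fin n) ℂ} (hf : IsConvergent f)
    (hg : IsConvergent g) : IsConvergent (f + g) := by
  obtain ⟨r, hr, hf⟩ := hf
  obtain ⟨s, hs, hg⟩ := hg
  have hm : 0 < min r s := lt_min hr hs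
  refine ⟨min r s, hm, Summable.of_nonneg_of_le (fun a => by positivity) (fun a => ?_)
    ((IsConvergent.mono hm (min_le_left r s) hf).add
      (IsConvergent.mono hm (min_le_right r s) hg))⟩
  rw [← add_mul, map_add]
  gcongr
  exact norm_add_le _ _

theorem norm_coeff_mul_le {n : ℕ} (f g : MvPowerSeries (Fin n) ℂ) {t : ℝ} (hm : 0 < t)
    (a : Fin n →₀ ℕ) :
    ‖MvPowerSeries.coeff a (f * g)‖ * t ^ a.degree ≤
      ∑ kl ∈ Finset.HasAntidiagonal.antidiagonal a,
        (‖MvPowerSeries.coeff kl.1 f‖ * t ^ kl.1.degree) *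
          (‖MvPowerSeries.coeff kl.2 g‖ * t ^ kl.2.degree) := by
  rw [MvPowerSeries.coeff_mul]
  refine (mul_le_mul_of_nonneg_right (norm_sum_le _ _) (pow_nonneg hm.le _)).trans ?_
  rw [Finset.sum_mul]
  refine Finset.sum_le_sum fun kl hkl => le_of_eq ?_
  have hd : a.degree = kl.1.degree + kl.2.degree := by
    rw [← map_add, Finset.HasAntidiagonal.mem_antidiagonal.mp hkl]
  rw [norm_mul, hd, pow_add, mul_mul_mul_comm]

theorem summable_antidiagonal {n : ℕ} {f g : (Fin n →₀ ℕ) → ℝ} (hf : Summable f) (hg : Summable g)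
    (hf0 : 0 ≤ f) (hg0 : 0 ≤ g) :
    Summable fun a => ∑ kl ∈ Finset.HasAntidiagonal.antidiagonal a, f kl.1 * g kl.2 :=
  summable_sum_mul_antidiagonal_of_summable_mul (hf.mul_of_nonneg hg hf0 hg0)

theorem summable_mul {n : ℕ} {f g : MvPowerSeries (Fin n) ℂ} {t : ℝ} (hm : 0 < t)
    (hf : Summable fun a : Fin n →₀ ℕ => ‖MvPowerSeries.coeff a f‖ * t ^ a.degree)
    (hg : Summable fun a : Fin n →₀ ℕ => ‖MvPowerSeries.coeff a g‖ * t ^ a.degree) :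
    Summable fun a : Fin n →₀ ℕ => ‖MvPowerSeries.coeff a (f * g)‖ * t ^ a.degree := by
  have key := summable_antidiagonal hf hg
      (fun a => mul_nonneg (norm_nonneg _) (pow_nonneg hm.le _))
      (fun a => mul_nonneg (norm_nonneg _) (pow_nonneg hm.le _))
  exact Summable.of_nonneg_of_le
    (fun a => mul_nonneg (norm_nonneg _) (pow_nonneg hm.le _)) (norm_coeff_mul_le f g hm) key

theorem IsConvergent.mul {n : ℕ} {f g : MvPowerSeries (Fin n) ℂ} (hf : IsConvergent f)
    (hg : IsConvergent g) : IsConvergent (f * g) := by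
  obtain ⟨r, hr, hf⟩ := hf
  obtain ⟨s, hs, hg⟩ := hg
  have hm : 0 < min r s := lt_min hr hs
  exact ⟨min r s, hm, summable_mul hm (IsConvergent.mono hm (min_le_left r s) hf)
    (IsConvergent.mono hm (min_le_right r s) hg)⟩

theorem isConvergent_coe {n : ℕ} (p : MvPolynomial (Fin n) ℂ) :
    IsConvergent (p : MvPowerSeries (Fin n) ℂ) := by
  refine ⟨1, one_pos, summable_of_hasFiniteSupport (p.support.finite_toSet.subset fun a ha => ?_)⟩
  simpa [MvPolynomial.coeff_coe] using ha

/-- The ring `ℂ{x₁, …, xₙ}` of convergent power series, as a `ℂ`-subalgebra of the ring of formal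
power series. -/
noncomputable def O (n : ℕ) : Subalgebra ℂ (MvPowerSeries (Fin n) ℂ) where
  carrier := {f | IsConvergent f}
  mul_mem' := IsConvergent.mul
  add_mem' := IsConvergent.add
  algebraMap_mem' c := by
    have h := isConvergent_coe (n := n) (MvPolynomial.C c)
    rwa [MvPolynomial.coe_C] at h

/-- A polynomial, regarded as a convergent power series. -/
noncomputable def ofPoly {n : ℕ} (p : MvPolynomial (Fin n) ℂ) : O n :=
  ⟨(p : MvPowerSeries (Fin n) ℂ), isConvergent_coe p⟩

/-- The maximal ideal of `ℂ{x₁, …, xₙ}`: the convergent power series vanishing at the origin. -/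
noncomputable def maxIdeal (n : ℕ) : Ideal (O n) :=
  RingHom.ker ((MvPowerSeries.constantCoeff (σ := Fin n) (R := ℂ)).comp (O n).val.toRingHom)

/-- The `k`-truncation of `f`: its image in `ℂ{x₁, …, xₙ} / 𝔪 ^ (k + 1)`. -/
noncomputable def truncation {n : ℕ} (k : ℕ) (f : O n) : O n ⧸ maxIdeal n ^ (k + 1) :=
  Ideal.Quotient.mk (maxIdeal n ^ (k + 1)) f

/-- Right equivalence: some automorphism of the `ℂ`-algebra `ℂ{x₁, …, xₙ}` takes `f` to `g`. -/
def RightEquivalent {n : ℕ} (f g : O n) : Prop :=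
  ∃ φ : O n ≃ₐ[ℂ] O n, φ f = g

/-- `f` is right `k`-determined: every convergent power series with the same `k`-truncation
as `f` is right equivalent to `f`. -/
def IsRightDetermined {n : ℕ} (k : ℕ) (f : O n) : Prop :=
  ∀ g : O n, truncation k f = truncation k g → RightEquivalent f g

/-- The hypersurface germs `{f = 0}` and `{g = 0}` at the origin are analytically equivalent
(`f` and `g` are contact equivalent): an automorphism of `ℂ{x₁, …, xₙ}` carries the ideal
generated by `f` onto the ideal generated by `g`. -/
def GermsEquivalent {n : ℕ} (f g : O n) : Prop :=
  ∃ φ : O n ≃ₐ[ℂ] O n, Ideal.map φ (Ideal.span {f}) = Ideal.span {g}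

/-- `f` is a regular homogeneous polynomial of degree `m`: the hypersurface `{f = 0}` of
`ℙⁿ⁻¹(ℂ)` is smooth, i.e. at each of its points some partial derivative of `f` is nonzero. -/
structure IsRegularHomogeneous {n : ℕ} (f : MvPolynomial (Fin n) ℂ) (m : ℕ) : Prop where
  homogeneous : f.IsHomogeneous m
  smooth : ∀ x : Fin n → ℂ, x ≠ 0 → MvPolynomial.eval x f = 0 →
    ∃ i, MvPolynomial.eval x (MvPolynomial.pderiv i f) ≠ 0

/-- The integers `D > m` such that, for every regular homogeneous polynomial `f` of degree `m` in
`n` variables and every `d ≥ D`, each convergent power series `g = f + o(d)`, where `o(d)` has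
order at least `d`, defines a germ `{g = 0}` analytically equivalent to `{f = 0}`. -/
def determinacyBounds (n m : ℕ) : Set ℕ :=
  {D | m < D ∧ ∀ f : MvPolynomial (Fin n) ℂ, IsRegularHomogeneous f m → ∀ d : ℕ, D ≤ d →
    ∀ g : O n, (d : ℕ∞) ≤ MvPowerSeries.order ((g - ofPoly f : O n) : MvPowerSeries (Fin n) ℂ) →
      GermsEquivalent (ofPoly f) g}

/-- `D(n, m)`, the smallest element of `determinacyBounds n m` (when there is one). -/
noncomputable def D (n m : ℕ) : ℕ := sInf (determinacyBounds n m)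

end ConvergentSeries

/-!
The theorem combines an algebraic bound with an analytic fixed point argument.

*Algebra.* By Euler's identity the `n` partial derivatives of a regular form `f` of degree `m` have no
common zero, so by Macaulay's theorem (`isRegularFamily_and_forall_mem_span`) they generate all
forms of degree greater than `n (m - 2)`. For that theorem, the forms are exchanged one at a time
for linear ones. A common-zero-free family stays such a family when one member `a j` is replaced by
a linear form that does not vanish on the finite set where the other members are `0` and `a j` is `1`
(`exists_linear_update`). In the opposite direction, both regularity in every order and the degree
bound pass from the family with a linear form `l` to the family with `b` of degree `e + 1` in its
place: `b` is regular modulo the other members because a power of `l` lies in the ideal they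
generate together with `b`, and the bound grows by `e` because injective multiplication by `b`
between graded pieces of non-increasing dimension is bijective (`IsRegularFamily.update`,
`homogeneous_mem_sup_of_isRegularMod`). Linear forms without a common zero are coordinates.

*Analysis.* Let `h` be convergent of order greater than `n (m - 2)`. The equation `f (x + u) = f + h`
reads `∑ i, u i * ∂f/∂x_i = h - Q u` with `Q` the second order Taylor remainder. Since the forms of
degree `n (m - 2) + 1` are combinations of the derivatives, division by the derivatives has an
additive right inverse `L`, bounded for the weighted `ℓ¹` norms `∑ |f_a| r ^ |a|`
(`exists_division`), and `u` is a fixed point of `u ↦ L (h - Q u)`. The quotients have order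
`(n - 1) (m - 2) ≥ 2`, which is where the pair `(2, 3)` drops out. The map therefore raises the order
of differences, which gives a formal solution, and it preserves a small ball of the norm of
some radius `r`, which makes the solution convergent (`exists_fixedPoint`, `exists_aeval_add_eq`).
The same fixed point lemma inverts `x ↦ x + u` (`exists_inverse`), so this substitution is an
automorphism of the ring of convergent power series (`bijective_substHom`), and it takes `f` to
`f + h`.
-/

namespace ConvergentSeries

/-! ### Regular families of forms -/

section Forms

open MvPolynomial

variable {K σ ι : Type*} [Field K]

theorem homogeneousComponent_mul_of_isHomogeneous (p : MvPolynomial σ K) {q : MvPolynomial σ K}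
    {e : ℕ} (hq : q.IsHomogeneous e) (d : ℕ) :
    homogeneousComponent d (p * q) =
      if e ≤ d then homogeneousComponent (d - e) p * q else 0 := by
  let _ := MvPolynomial.gradedAlgebra (σ := σ) (R := K)
  have h : ∀ (r : MvPolynomial σ K) (i : ℕ),
      (DirectSum.decompose (homogeneousSubmodule σ K) r i : MvPolynomial σ K) =
        homogeneousComponent i r := fun r i => decomposition.decompose'_apply r i
  rw [← h, ← h]
  exact DirectSum.coe_decompose_mul_of_right_mem (homogeneousSubmodule σ K) d hq

theorem homogeneousComponent_mem_span {s : Set (MvPolynomial σ K)}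
    (hs : ∀ x ∈ s, ∃ d, x.IsHomogeneous d) {p : MvPolynomial σ K} (hp : p ∈ Ideal.span s) (d : ℕ) :
    homogeneousComponent d p ∈ Ideal.span s := by
  let _ := MvPolynomial.gradedAlgebra (σ := σ) (R := K)
  exact homogeneousComponent_mem_of_mem (Ideal.homogeneous_span _ s hs) hp d

/-- Krull's intersection theorem for a homogeneous ideal and a form of positive degree. -/
theorem mem_of_forall_mem_sup_pow {I : Ideal (MvPolynomial σ K)}
    (hI : ∀ p ∈ I, ∀ d, homogeneousComponent d p ∈ I) {a : MvPolynomial σ K} {e : ℕ}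
    (ha : a.IsHomogeneous (e + 1)) {v : MvPolynomial σ K}
    (hv : ∀ k, v ∈ I ⊔ Ideal.span {a ^ k}) : v ∈ I := by
  rw [← sum_homogeneousComponent v]
  refine Ideal.sum_mem _ fun d _ => ?_
  obtain ⟨i, hi, w, hw, rfl⟩ := Submodule.mem_sup.mp (hv (d + 1))
  obtain ⟨w, rfl⟩ := Ideal.mem_span_singleton'.mp hw
  have h0 : ¬ (e + 1) * (d + 1) ≤ d := by nlinarith [Nat.zero_le (e * (d + 1))]
  rw [map_add, homogeneousComponent_mul_of_isHomogeneous w (ha.pow (d + 1)), if_neg h0, add_zero]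
  exact hI i hi d

/-- `b` is a nonzerodivisor modulo the ideal `I`. -/
def IsRegularMod {R : Type*} [CommRing R] (I : Ideal R) (b : R) : Prop :=
  ∀ v, v * b ∈ I → v ∈ I

/-- The family `a` is a regular sequence in every order: each member is a nonzerodivisor modulo the
ideal generated by any set of other members. -/
def IsRegularFamily {R : Type*} [CommRing R] (a : ι → R) : Prop :=
  ∀ (s : Set ι) (i : ι), i ∉ s → IsRegularMod (Ideal.span (a '' s)) (a i)

theorem IsRegularMod.pow {R : Type*} [CommRing R] {I : Ideal R} {b : R} (h : IsRegularMod I b)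
    (k : ℕ) : IsRegularMod I (b ^ k) := by
  induction k with
  | zero => intro v hv; simpa using hv
  | succ k ih =>
    intro v hv
    refine ih v (h _ ?_)
    rwa [mul_assoc, ← pow_succ]

/-- If a power of a regular element `l` lies in `I + (b)`, then `b` is regular as well: a multiple
`v * b` in `I` forces `v * l ^ N` into `I`. -/
theorem IsRegularMod.of_pow_mem {R : Type*} [CommRing R] {I : Ideal R} {l b : R}
    (hl : IsRegularMod I l) {N : ℕ} (hN : l ^ N ∈ I ⊔ Ideal.span {b}) : IsRegularMod I b := by
  intro v hv
  refine hl.pow N v ?_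
  obtain ⟨i, hi, w, hw, h⟩ := Submodule.mem_sup.mp hN
  obtain ⟨w, rfl⟩ := Ideal.mem_span_singleton'.mp hw
  rw [← h, mul_add]
  refine add_mem (I.mul_mem_left _ hi) ?_
  convert I.mul_mem_left w hv using 1
  ring

/-- If `b` is regular modulo `I + (a)` and the form `a` is regular modulo `I`, then `b` is regular
modulo `I`. -/
theorem IsRegularMod.of_sup {I : Ideal (MvPolynomial σ K)}
    (hI : ∀ p ∈ I, ∀ d, homogeneousComponent d p ∈ I) {a b : MvPolynomial σ K} {e : ℕ}
    (ha : a.IsHomogeneous (e + 1)) (hra : IsRegularMod I a)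
    (hb : IsRegularMod (I ⊔ Ideal.span {a}) b) : IsRegularMod I b := by
  intro v hv
  have key : ∀ k, ∃ i ∈ I, ∃ w, v = i + w * a ^ k ∧ w * b ∈ I := by
    intro k
    induction k with
    | zero => exact ⟨0, I.zero_mem, v, by simp, hv⟩
    | succ k ih =>
      obtain ⟨i, hi, w, rfl, hwb⟩ := ih
      obtain ⟨i', hi', u, hu, rfl⟩ := Submodule.mem_sup.mp (hb w (Ideal.mem_sup_left hwb))
      obtain ⟨u, rfl⟩ := Ideal.mem_span_singleton'.mp hu
      refine ⟨i + i' * a ^ k, add_mem hi (I.mul_mem_right _ hi'), u, by ring, hra _ ?_⟩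
      have := I.sub_mem hwb (I.mul_mem_right b hi')
      convert this using 1
      ring
  refine mem_of_forall_mem_sup_pow hI ha fun k => ?_
  obtain ⟨i, hi, w, h, -⟩ := key k
  rw [h]
  exact add_mem (Ideal.mem_sup_left hi)
    (Ideal.mem_sup_right (Ideal.mul_mem_left _ _ (Ideal.mem_span_singleton_self _)))

theorem span_image_insert {R : Type*} [CommRing R] (a : ι → R) (s : Set ι) (j : ι) :
    Ideal.span (a '' insert j s) = Ideal.span (a '' s) ⊔ Ideal.span {a j} := by
  rw [Set.image_insert_eq, Ideal.span_insert, sup_comm]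

theorem image_update_of_notMem {R : Type*} [DecidableEq ι] (a : ι → R) {s : Set ι} {j : ι} (b : R)
    (hj : j ∉ s) : Function.update a j b '' s = a '' s :=
  Set.image_congr fun x hx => Function.update_of_ne (fun h : x = j => hj (h ▸ hx)) _ _

/-- Exchange: in a regular family of forms of positive degree the member with index `j` may be
replaced by `b`, as soon as a power of that member lies in the ideal of the new family. -/
theorem IsRegularFamily.update [Finite ι] [DecidableEq ι] {a : ι → MvPolynomial σ K}
    (ha : IsRegularFamily a) {e : ι → ℕ} (he : ∀ i, (a i).IsHomogeneous (e i + 1)) (j : ι)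
    {b : MvPolynomial σ K} {N : ℕ} (hN : a j ^ N ∈ Ideal.span (a '' {j}ᶜ) ⊔ Ideal.span {b}) :
    IsRegularFamily (Function.update a j b) := by
  have hhom : ∀ s : Set ι, ∀ p ∈ Ideal.span (a '' s), ∀ d,
      homogeneousComponent d p ∈ Ideal.span (a '' s) := fun s p hp d =>
    homogeneousComponent_mem_span (by rintro _ ⟨i, -, rfl⟩; exact ⟨_, he i⟩) hp d
  -- `b` is regular modulo all the other members, hence modulo any of them by dropping one at a time
  have hb : ∀ t : Set ι, j ∉ t → IsRegularMod (Ideal.span (a '' (({j} : Set ι)ᶜ \ t))) b := by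
    intro t
    refine Set.Finite.induction_on (motive := fun t _ => j ∉ t →
      IsRegularMod (Ideal.span (a '' (({j} : Set ι)ᶜ \ t))) b) t (Set.toFinite t) ?_ ?_
    · intro _
      rw [Set.sdiff_empty]
      exact (ha _ j (by simp)).of_pow_mem hN
    · intro i t hit _ ih hj
      have hjt : j ∉ t := fun h => hj (Set.mem_insert_of_mem _ h)
      have hij : i ≠ j := fun h => hj (h ▸ Set.mem_insert _ _)
      refine IsRegularMod.of_sup (hhom _) (he i) (ha _ i (by simp)) ?_
      rw [← span_image_insert]
      convert ih hjt using 4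
      ext x
      simp only [Set.mem_insert_iff, Set.mem_sdiff, Set.mem_compl_iff, Set.mem_singleton_iff]
      by_cases hx : x = i
      · subst hx; simp [hij, hit]
      · simp [hx]
  have hb' : ∀ s : Set ι, j ∉ s → IsRegularMod (Ideal.span (a '' s)) b := by
    intro s hs
    convert hb (({j} : Set ι)ᶜ \ s) (by simp) using 3
    ext x
    simp only [Set.mem_sdiff, Set.mem_compl_iff, Set.mem_singleton_iff]
    constructor
    · intro hx
      exact ⟨fun h => hs (h ▸ hx), fun h => h.2 hx⟩
    · rintro ⟨h1, h2⟩
      by_contra h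
      exact h2 ⟨h1, h⟩
  intro s i hi
  by_cases hij : i = j
  · subst hij
    rw [Function.update_self, image_update_of_notMem _ _ hi]
    exact hb' s hi
  rw [Function.update_of_ne hij]
  by_cases hj : j ∈ s
  · -- `s = t ∪ {j}`: swap the roles of `a i` and `b`
    obtain ⟨t, hjt, rfl⟩ : ∃ t : Set ι, j ∉ t ∧ s = insert j t :=
      ⟨s \ {j}, by simp, by rw [Set.insert_sdiff_singleton, Set.insert_eq_of_mem hj]⟩
    have hit : i ∉ t := fun h => hi (Set.mem_insert_of_mem _ h)
    rw [span_image_insert, image_update_of_notMem _ _ hjt, Function.update_self]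
    intro v hv
    obtain ⟨p, hp, w, hw, h⟩ := Submodule.mem_sup.mp hv
    obtain ⟨w, rfl⟩ := Ideal.mem_span_singleton'.mp hw
    have hw : w ∈ Ideal.span (a '' insert i t) := by
      refine hb' _ (by simp [Ne.symm hij, hjt]) w ?_
      rw [span_image_insert, eq_sub_of_add_eq' h]
      exact sub_mem (Ideal.mem_sup_right (Ideal.mul_mem_left _ _ (Ideal.mem_span_singleton_self _)))
        (Ideal.mem_sup_left hp)
    rw [span_image_insert] at hw
    obtain ⟨q, hq, u, hu, rfl⟩ := Submodule.mem_sup.mp hw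
    obtain ⟨u, rfl⟩ := Ideal.mem_span_singleton'.mp hu
    have h1 : v - u * b ∈ Ideal.span (a '' t) := by
      refine ha t i hit _ ?_
      have : (v - u * b) * a i = p + q * b := by linear_combination -h
      rw [this]
      exact add_mem hp (Ideal.mul_mem_right _ _ hq)
    rw [← sub_add_cancel v (u * b)]
    exact add_mem (Ideal.mem_sup_left h1)
      (Ideal.mem_sup_right (Ideal.mul_mem_left _ _ (Ideal.mem_span_singleton_self _)))
  · rw [image_update_of_notMem _ _ hj]
    exact ha s i hi

/-- Degree bound under an exchange: modulo a homogeneous ideal `I`, let `l` be a linear form and `b`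
a regular form of degree `e + 1`. If `I + (l)` contains all forms of degree greater than `δ`, then
`I + (b)` contains all forms of degree greater than `δ + e`. In degrees `≥ δ` the dimensions of the
graded pieces of the quotient by `I` do not increase, because multiplication by `l` is surjective,
so the injective multiplication by `b` is bijective. -/
theorem homogeneous_mem_sup_of_isRegularMod [Finite σ] {I : Ideal (MvPolynomial σ K)}
    (hI : ∀ p ∈ I, ∀ d, homogeneousComponent d p ∈ I) {l b : MvPolynomial σ K} {e δ : ℕ}
    (hl : l.IsHomogeneous 1) (hb : b.IsHomogeneous (e + 1)) (hrb : IsRegularMod I b)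
    (hδ : ∀ d, δ < d → ∀ p : MvPolynomial σ K, p.IsHomogeneous d → p ∈ I ⊔ Ideal.span {l})
    {d : ℕ} (hd : δ + e < d) {p : MvPolynomial σ K} (hp : p.IsHomogeneous d) :
    p ∈ I ⊔ Ideal.span {b} := by
  let V : ℕ → Submodule K (MvPolynomial σ K ⧸ I) := fun d =>
    (homogeneousSubmodule σ K d).map (Ideal.Quotient.mkₐ K I).toLinearMap
  have hfin : ∀ d, Module.Finite K (V d) := fun d =>
    Module.Finite.iff_fg.mpr ((homogeneousSubmodule_fg σ K d).map _)
  let M : MvPolynomial σ K → (MvPolynomial σ K ⧸ I) →ₗ[K] (MvPolynomial σ K ⧸ I) := fun q =>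
    LinearMap.mulRight K (Ideal.Quotient.mk I q)
  have hl' : ∀ d, δ ≤ d → V (d + 1) ≤ (V d).map (M l) := by
    rintro d hd _ ⟨q, hq, rfl⟩
    obtain ⟨i, hi, w, hw, h⟩ := Submodule.mem_sup.mp (hδ (d + 1) (by lia) q hq)
    obtain ⟨w, rfl⟩ := Ideal.mem_span_singleton'.mp hw
    refine ⟨_, ⟨homogeneousComponent d w, homogeneousComponent_mem d w, rfl⟩, ?_⟩
    have h2 := congrArg (homogeneousComponent (d + 1)) h
    rw [map_add, homogeneousComponent_mul_of_isHomogeneous w hl, if_pos (by lia),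
      homogeneousComponent_eq_self hq, Nat.add_sub_cancel] at h2
    change Ideal.Quotient.mk I _ * Ideal.Quotient.mk I l = Ideal.Quotient.mk I q
    rw [← map_mul, ← h2, map_add, Ideal.Quotient.eq_zero_iff_mem.mpr (hI i hi _), zero_add]
  have hmono : ∀ d, δ ≤ d → Module.finrank K (V (d + 1)) ≤ Module.finrank K (V d) := fun d hd =>
    (Submodule.finrank_mono (hl' d hd)).trans (Submodule.finrank_map_le _ _)
  have hmono' : ∀ k d, δ ≤ d → Module.finrank K (V (d + k)) ≤ Module.finrank K (V d) := by
    intro k d hd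
    induction k with
    | zero => exact le_rfl
    | succ k ih => exact (hmono (d + k) (by lia)).trans ih
  have hinj : Function.Injective (M b) := by
    rw [injective_iff_map_eq_zero]
    intro x hx
    obtain ⟨v, rfl⟩ := Ideal.Quotient.mk_surjective x
    change Ideal.Quotient.mk I v * Ideal.Quotient.mk I b = 0 at hx
    rw [← map_mul, Ideal.Quotient.eq_zero_iff_mem] at hx
    exact Ideal.Quotient.eq_zero_iff_mem.mpr (hrb v hx)
  obtain ⟨c, rfl⟩ : ∃ c, d = c + (e + 1) := ⟨d - (e + 1), by lia⟩
  have hle : (V c).map (M b) ≤ V (c + (e + 1)) := by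
    rintro _ ⟨_, ⟨q, hq, rfl⟩, rfl⟩
    exact ⟨q * b, IsHomogeneous.mul hq hb, by rw [AlgHom.toLinearMap_apply, map_mul]; rfl⟩
  have heq : (V c).map (M b) = V (c + (e + 1)) := by
    refine Submodule.eq_of_le_of_finrank_le hle ?_
    have h1 := (Submodule.equivMapOfInjective (M b) hinj (V c)).finrank_eq
    rw [← h1]
    exact hmono' _ _ (by lia)
  have hpV : Ideal.Quotient.mk I p ∈ V (c + (e + 1)) := ⟨p, hp, rfl⟩
  rw [← heq] at hpV
  obtain ⟨_, ⟨q, -, rfl⟩, h⟩ := hpV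
  change Ideal.Quotient.mk I q * Ideal.Quotient.mk I b = _ at h
  rw [← map_mul, Ideal.Quotient.mk_eq_mk_iff_sub_mem] at h
  rw [← sub_sub_cancel (q * b) p]
  exact sub_mem (Ideal.mem_sup_right (Ideal.mul_mem_left _ _ (Ideal.mem_span_singleton_self _)))
    (Ideal.mem_sup_left h)

/-! ### Replacing a form by a linear form -/

theorem exists_forall_isHomogeneous_mem [IsAlgClosed K] [Finite σ] {a : ι → MvPolynomial σ K}
    (h : ∀ x, (∀ i, eval x (a i) = 0) → x = 0) :
    ∃ D, ∀ d, D ≤ d → ∀ p : MvPolynomial σ K, p.IsHomogeneous d →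
      p ∈ Ideal.span (Set.range a) := by
  have hle : idealOfVars σ K ≤ (Ideal.span (Set.range a)).radical := by
    rw [← vanishingIdeal_zeroLocus_eq_radical (K := K), idealOfVars, Ideal.span_le]
    rintro _ ⟨j, rfl⟩
    rw [SetLike.mem_coe, mem_vanishingIdeal_iff]
    intro x hx
    have : x = 0 := h x fun i => by
      have := hx (a i) (Ideal.subset_span ⟨i, rfl⟩)
      rwa [aeval_eq_eval] at this
    simp [this]
  obtain ⟨D, hD⟩ := Ideal.exists_pow_le_of_le_radical_of_fg hle
    (Submodule.fg_span (Set.finite_range _))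
  refine ⟨D, fun d hd p hp => hD ?_⟩
  rw [mem_pow_idealOfVars_iff]
  intro x hx
  rwa [hp.degree_eq_sum_deg_support hx] at hd

/-- On the common zeros of `a i`, `i ≠ j`, where `a j = 1`, every polynomial agrees with one of
bounded degree. -/
theorem exists_restrictTotalDegree_eval_eq {a : ι → MvPolynomial σ K} {e : ι → ℕ}
    (he : ∀ i, (a i).IsHomogeneous (e i + 1)) {D : ℕ}
    (hD : ∀ d, D ≤ d → ∀ p : MvPolynomial σ K, p.IsHomogeneous d → p ∈ Ideal.span (Set.range a))
    (j : ι) {d : ℕ} (p : MvPolynomial σ K) (hp : p.IsHomogeneous d) :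
    ∃ q ∈ restrictTotalDegree σ K D, ∀ z, (∀ i ≠ j, eval z (a i) = 0) → eval z (a j) = 1 →
      eval z q = eval z p := by
  induction d using Nat.strong_induction_on generalizing p with
  | _ d ih =>
  rcases lt_or_ge d D with hd | hd
  · exact ⟨p, (mem_restrictTotalDegree _ _ _).mpr (hp.totalDegree_le.trans hd.le),
      fun _ _ _ => rfl⟩
  have hm := hD d hd p hp
  have hU : Set.range a = a '' insert j {j}ᶜ := by
    rw [← Set.image_univ]; congr 1; ext x; simp [em]
  rw [hU, span_image_insert] at hm
  obtain ⟨i, hi, w, hw, h⟩ := Submodule.mem_sup.mp hm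
  obtain ⟨w, rfl⟩ := Ideal.mem_span_singleton'.mp hw
  have hz : ∀ z, (∀ i ≠ j, eval z (a i) = 0) → ∀ q ∈ Ideal.span (a '' {j}ᶜ), eval z q = 0 := by
    intro z hz q hq
    have : Ideal.span (a '' {j}ᶜ) ≤ RingHom.ker (eval z) := by
      rw [Ideal.span_le]
      rintro _ ⟨i, hi, rfl⟩
      exact hz i hi
    exact this hq
  have hi' := homogeneousComponent_mem_span (by rintro _ ⟨i, -, rfl⟩; exact ⟨_, he i⟩) hi d
  have h2 := congrArg (homogeneousComponent d) h
  rw [map_add, homogeneousComponent_mul_of_isHomogeneous w (he j),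
    homogeneousComponent_eq_self hp] at h2
  split_ifs at h2 with hed
  · obtain ⟨q, hq, hq'⟩ := ih (d - (e j + 1)) (by lia) _ (homogeneousComponent_mem _ w)
    refine ⟨q, hq, fun z h0 h1 => ?_⟩
    rw [hq' z h0 h1, ← h2, map_add, hz z h0 _ hi', map_mul, h1, mul_one, zero_add]
  · refine ⟨0, Submodule.zero_mem _, fun z h0 _ => ?_⟩
    rw [← h2, add_zero, hz z h0 _ hi', map_zero]

/-- If forms of positive degree generate all forms of large degree, then the common zeros of all but
one of them meet the level set `a j = 1` of the last one in finitely many points. -/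
theorem finite_zeros_level_one [Finite σ] {a : ι → MvPolynomial σ K} {e : ι → ℕ}
    (he : ∀ i, (a i).IsHomogeneous (e i + 1)) {D : ℕ}
    (hD : ∀ d, D ≤ d → ∀ p : MvPolynomial σ K, p.IsHomogeneous d → p ∈ Ideal.span (Set.range a))
    (j : ι) : {z : σ → K | (∀ i ≠ j, eval z (a i) = 0) ∧ eval z (a j) = 1}.Finite := by
  set Z := {z : σ → K | (∀ i ≠ j, eval z (a i) = 0) ∧ eval z (a j) = 1}
  let R : MvPolynomial σ K →ₗ[K] (Z → K) := LinearMap.pi fun z => (aeval (z : σ → K)).toLinearMap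
  let W : Submodule K (Z → K) := (restrictTotalDegree σ K D).map R
  have : Module.Finite K W := Module.Finite.map _ _
  -- the powers of each coordinate function are linearly dependent on `Z`
  have hcoord : ∀ k : σ, ∃ q : Polynomial K, q ≠ 0 ∧ ∀ z ∈ Z, q.eval (z k) = 0 := by
    intro k
    have hmem : ∀ q : Polynomial K, R (Polynomial.aeval (X k) q) ∈ W := by
      intro q
      induction q using Polynomial.induction_on' with
      | add p q hp hq => rw [map_add, map_add]; exact add_mem hp hq
      | monomial t c =>
        rw [Polynomial.aeval_monomial, algebraMap_eq, ← smul_eq_C_mul, map_smul]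
        refine W.smul_mem c ?_
        obtain ⟨q, hq, hq'⟩ := exists_restrictTotalDegree_eval_eq he hD j _
          (isHomogeneous_X_pow (R := K) k t)
        refine ⟨q, hq, funext fun z => ?_⟩
        have := hq' z z.2.1 z.2.2
        simpa [R, aeval_eq_eval] using this
    let T : Polynomial K →ₗ[K] W :=
      LinearMap.codRestrict W (R ∘ₗ (Polynomial.aeval (X k)).toLinearMap) hmem
    have hT : ¬ Function.Injective T := fun h =>
      Polynomial.not_finite (R := K) (Module.Finite.of_injective T h)
    rw [injective_iff_map_eq_zero] at hT
    push Not at hT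
    obtain ⟨q, hq, hq0⟩ := hT
    refine ⟨q, hq0, fun z hz => ?_⟩
    have h1 := congrFun (congrArg Subtype.val hq) ⟨z, hz⟩
    have h2 : aeval z (Polynomial.aeval (X k : MvPolynomial σ K) q) = 0 := h1
    rwa [← Polynomial.aeval_algHom_apply, aeval_X, Polynomial.coe_aeval_eq_eval] at h2
  choose q hq0 hq using hcoord
  refine (Set.Finite.pi' fun k => (q k).rootSet_finite K).subset fun z hz k => ?_
  rw [Polynomial.mem_rootSet]
  exact ⟨hq0 k, by rw [Polynomial.coe_aeval_eq_eval]; exact hq k z hz⟩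

theorem eval_smul_of_isHomogeneous {p : MvPolynomial σ K} {d : ℕ} (hp : p.IsHomogeneous d)
    (t : K) (x : σ → K) : eval (t • x) p = t ^ d * eval x p := by
  rw [eval_eq, eval_eq, Finset.mul_sum]
  refine Finset.sum_congr rfl fun m hm => ?_
  simp only [Pi.smul_apply, smul_eq_mul, mul_pow, Finset.prod_mul_distrib]
  rw [Finset.prod_pow_eq_pow_sum, ← hp.degree_eq_sum_deg_support hm]
  ring

/-- Among forms without a common zero, each one may be replaced by a suitable linear form. -/
theorem exists_linear_update [IsAlgClosed K] [Finite σ] [DecidableEq ι]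
    {a : ι → MvPolynomial σ K} {e : ι → ℕ} (he : ∀ i, (a i).IsHomogeneous (e i + 1))
    (h : ∀ x, (∀ i, eval x (a i) = 0) → x = 0) (j : ι) :
    ∃ l : MvPolynomial σ K, l.IsHomogeneous 1 ∧
      ∀ x, (∀ i, eval x (Function.update a j l i) = 0) → x = 0 := by
  have := Fintype.ofFinite σ
  obtain ⟨D, hD⟩ := exists_forall_isHomogeneous_mem h
  have hZ := finite_zeros_level_one he hD j
  set Z := {z : σ → K | (∀ i ≠ j, eval z (a i) = 0) ∧ eval z (a j) = 1}
  have := hZ.to_subtype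
  have hZ0 : ∀ z : Z, (z : σ → K) ≠ 0 := by
    rintro ⟨z, -, hz⟩ (h0 : z = 0)
    rw [h0, ← zero_smul K (0 : σ → K), eval_smul_of_isHomogeneous (he j)] at hz
    simp at hz
  obtain ⟨f, hf⟩ := Module.exists_dual_forall_apply_ne_zero (K := K) (fun z : Z => (z : σ → K)) hZ0
  classical
  let l : MvPolynomial σ K := ∑ k, C (f fun i => if k = i then 1 else 0) * X k
  have hl : ∀ x, eval x l = f x := by
    intro x
    rw [LinearMap.pi_apply_eq_sum_univ f x]
    simp only [l, map_sum, map_mul, eval_C, eval_X, smul_eq_mul]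
    exact Finset.sum_congr rfl fun k _ => mul_comm _ _
  refine ⟨l, IsHomogeneous.sum _ _ _ fun k _ => isHomogeneous_C_mul_X _ _, fun x hx => ?_⟩
  have hxi : ∀ i ≠ j, eval x (a i) = 0 := fun i hi => by
    have := hx i; rwa [Function.update_of_ne hi] at this
  have hxl : f x = 0 := by have := hx j; rwa [Function.update_self, hl] at this
  refine h x fun i => ?_
  by_cases hi : i = j
  swap
  · exact hxi i hi
  subst hi
  by_contra hne
  -- rescale `x` to a point of `Z`
  obtain ⟨t, ht⟩ := IsAlgClosed.exists_pow_nat_eq (eval x (a i))⁻¹ (Nat.succ_pos (e i))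
  have hxZ : t • x ∈ Z := by
    refine ⟨fun k hk => ?_, ?_⟩
    · rw [eval_smul_of_isHomogeneous (he k), hxi k hk, mul_zero]
    · rw [eval_smul_of_isHomogeneous (he i), ht, inv_mul_cancel₀ hne]
  exact hf ⟨_, hxZ⟩ (by simp [hxl])

/-! ### Macaulay's theorem -/

theorem isRegularFamily_X : IsRegularFamily (X : σ → MvPolynomial σ K) := by
  intro s i hi v hv
  rw [mem_ideal_span_X_image] at hv ⊢
  intro m hm
  obtain ⟨j, hj, h⟩ := hv (m + Finsupp.single i 1) (by
    rw [mem_support_iff, coeff_mul_X]; exact mem_support_iff.mp hm)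
  refine ⟨j, hj, ?_⟩
  have hij : i ≠ j := fun h => hi (h ▸ hj)
  simpa [Finsupp.single_apply, hij] using h

theorem IsRegularFamily.map_equiv {R S : Type*} [CommRing R] [CommRing S] {a : ι → R}
    (ha : IsRegularFamily a) (φ : R ≃+* S) : IsRegularFamily fun i => φ (a i) := by
  intro s i hi v hv
  have hs : Ideal.span ((fun i => φ (a i)) '' s) = (Ideal.span (a '' s)).map φ := by
    rw [Ideal.map_span, Set.image_image]
  obtain ⟨w, rfl⟩ := φ.surjective v
  rw [hs, Ideal.mem_map_of_equiv] at hv ⊢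
  obtain ⟨x, hx, h⟩ := hv
  rw [← map_mul] at h
  exact ⟨w, ha s i hi w (φ.injective h ▸ hx), rfl⟩

/-- As many linear forms as variables, without a common zero, are a linear change of coordinates. -/
theorem exists_algEquiv_of_linear [Fintype σ] [DecidableEq σ] {a : σ → MvPolynomial σ K}
    (he : ∀ i, (a i).IsHomogeneous 1) (h : ∀ x, (∀ i, eval x (a i) = 0) → x = 0) :
    (∃ φ : MvPolynomial σ K ≃ₐ[K] MvPolynomial σ K, ∀ i, φ (X i) = a i) ∧
      idealOfVars σ K ≤ Ideal.span (Set.range a) := by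
  have hc : ∀ i, ∃ c : σ → K, ∑ j, c j • (X j : MvPolynomial σ K) = a i := by
    intro i
    rw [← Submodule.mem_span_range_iff_exists_fun, ← homogeneousSubmodule_one_eq_span_X]
    exact he i
  choose A hA using hc
  have hinj : Function.Injective (Matrix.of A).mulVec := by
    refine (injective_iff_map_eq_zero (Matrix.of A).mulVecLin).mpr fun x hx => h x fun i => ?_
    have hxi := congrFun hx i
    simpa [← hA, Matrix.mulVec, dotProduct, smul_eq_C_mul] using hxi
  have hdet : IsUnit (Matrix.of A).det := by
    rw [← Matrix.isUnit_iff_isUnit_det]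
    exact Matrix.mulVec_injective_iff_isUnit.mp hinj
  let B := (Matrix.of A)⁻¹
  have hAB : Matrix.of A * B = 1 := Matrix.mul_nonsing_inv _ hdet
  have hBA : B * Matrix.of A = 1 := Matrix.nonsing_inv_mul _ hdet
  have key : ∀ (P Q : Matrix σ σ K), P * Q = 1 → ∀ i : σ,
      ∑ j, P i j • (∑ k, Q j k • (X k : MvPolynomial σ K)) = X i := by
    intro P Q h i
    simp_rw [Finset.smul_sum, smul_smul]
    rw [Finset.sum_comm]
    simp_rw [← Finset.sum_smul, ← Matrix.mul_apply, h, Matrix.one_apply, ite_smul, one_smul,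
      zero_smul]
    simp
  refine ⟨⟨AlgEquiv.ofAlgHom (aeval a) (aeval fun j => ∑ i, B j i • X i) ?_ ?_, fun i => ?_⟩, ?_⟩
  · ext1 i
    simp only [AlgHom.comp_apply, aeval_X, map_sum, map_smul, AlgHom.id_apply]
    simp_rw [← hA]
    exact key B _ hBA i
  · ext1 i
    simp only [AlgHom.comp_apply, aeval_X, AlgHom.id_apply]
    rw [← hA]
    simp only [map_sum, map_smul, aeval_X]
    exact key _ B hAB i
  · simp
  · rw [idealOfVars, Ideal.span_le]
    rintro _ ⟨j, rfl⟩
    rw [SetLike.mem_coe, ← key B _ hBA j]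
    refine Ideal.sum_mem _ fun i _ => ?_
    rw [smul_eq_C_mul]
    exact Ideal.mul_mem_left _ _ (Ideal.subset_span ⟨i, (hA i).symm⟩)

/-- Macaulay's theorem: `n` forms of degrees `e i + 1` in `n` variables, without a common zero, form
a regular sequence and generate all forms of degree greater than `∑ i, e i`. -/
theorem isRegularFamily_and_forall_mem_span [IsAlgClosed K] [Fintype σ] [DecidableEq σ]
    (a : σ → MvPolynomial σ K) (e : σ → ℕ) (he : ∀ i, (a i).IsHomogeneous (e i + 1))
    (h : ∀ x, (∀ i, eval x (a i) = 0) → x = 0) :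
    IsRegularFamily a ∧ ∀ d, ∑ i, e i < d → ∀ p : MvPolynomial σ K, p.IsHomogeneous d →
      p ∈ Ideal.span (Set.range a) := by
  -- induction on the number of nonlinear members, replacing one of them by a linear form
  induction hN : (Finset.univ.filter fun i => e i ≠ 0).card generalizing a e with
  | zero =>
    have he0 : ∀ i, e i = 0 := by simpa [Finset.filter_eq_empty_iff] using hN
    simp only [he0, zero_add, Finset.sum_const_zero] at he ⊢
    obtain ⟨⟨φ, hφ⟩, hX⟩ := exists_algEquiv_of_linear he h
    obtain rfl : (fun i => φ (X i)) = a := funext hφ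
    refine ⟨isRegularFamily_X.map_equiv φ.toRingEquiv, fun d hd p hp => ?_⟩
    refine hX ?_
    rw [← pow_one (idealOfVars σ K), mem_pow_idealOfVars_iff]
    intro x hx
    rwa [hp.degree_eq_sum_deg_support hx] at hd
  | succ N ih =>
    obtain ⟨j, hj⟩ : ∃ j, e j ≠ 0 := by
      obtain ⟨j, hj⟩ := Finset.card_pos.mp (by rw [hN]; exact Nat.succ_pos N)
      exact ⟨j, (Finset.mem_filter.mp hj).2⟩
    obtain ⟨l, hl, hl0⟩ := exists_linear_update he h j
    have he' : ∀ i, (Function.update a j l i).IsHomogeneous (Function.update e j 0 i + 1) := by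
      intro i
      by_cases hi : i = j
      · subst hi; simpa using hl
      · simpa [hi] using he i
    have hcard : (Finset.univ.filter fun i => Function.update e j 0 i ≠ 0).card = N := by
      have : (Finset.univ.filter fun i => Function.update e j 0 i ≠ 0) =
          (Finset.univ.filter fun i => e i ≠ 0).erase j := by
        ext i
        by_cases hi : i = j
        · subst hi; simp
        · simp [hi]
      rw [this, Finset.card_erase_of_mem (by simpa using hj), hN, Nat.add_sub_cancel]
    obtain ⟨hreg, hbd⟩ := ih _ _ he' hl0 hcard
    have hsum : ∑ i, e i = ∑ i, Function.update e j 0 i + e j := by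
      rw [Finset.sum_update_of_mem (Finset.mem_univ j), zero_add,
        ← Finset.sum_sdiff (Finset.subset_univ {j}), Finset.sum_singleton]
    have hsplit : ∀ b : MvPolynomial σ K, Ideal.span (Set.range (Function.update a j b)) =
        Ideal.span (a '' {j}ᶜ) ⊔ Ideal.span {b} := by
      intro b
      have hU : Set.range (Function.update a j b) = Function.update a j b '' insert j {j}ᶜ := by
        rw [← Set.image_univ]; congr 1; ext x; simp [em]
      rw [hU, span_image_insert, image_update_of_notMem _ _ (by simp), Function.update_self]
    have ha : Function.update a j (a j) = a := Function.update_eq_self _ _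
    obtain ⟨D, hD⟩ := exists_forall_isHomogeneous_mem h
    have hlD : l ^ D ∈ Ideal.span (a '' {j}ᶜ) ⊔ Ideal.span {a j} := by
      rw [← hsplit, ha]
      exact hD D le_rfl _ (by simpa using hl.pow D)
    have hreg' : IsRegularFamily a := by
      have := hreg.update he' j (b := a j) (N := D)
        (by rw [Function.update_self, image_update_of_notMem _ _ (by simp)]; exact hlD)
      rwa [Function.update_idem, ha] at this
    refine ⟨hreg', fun d hd p hp => ?_⟩
    rw [← ha, hsplit]
    refine homogeneous_mem_sup_of_isRegularMod (δ := ∑ i, Function.update e j 0 i) (d := d)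
      (fun q hq d => homogeneousComponent_mem_span (by rintro _ ⟨i, -, rfl⟩; exact ⟨_, he i⟩) hq d)
      hl (he j) (hreg' _ _ (by simp)) (fun d hd p hp => ?_) (hsum ▸ hd) hp
    rw [← hsplit]
    exact hbd d hd p hp

/-- For a regular form `f` of degree `m`, every form of degree greater than `n * (m - 2)` is a
combination of the partial derivatives of `f`. -/
theorem IsRegularHomogeneous.exists_sum_mul_pderiv {n m : ℕ} (hm : 2 ≤ m)
    {f : MvPolynomial (Fin n) ℂ} (hf : IsRegularHomogeneous f m) {d : ℕ}
    (hd : n * (m - 2) < d + (m - 1)) {p : MvPolynomial (Fin n) ℂ}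
    (hp : p.IsHomogeneous (d + (m - 1))) :
    ∃ b : Fin n → MvPolynomial (Fin n) ℂ, (∀ i, (b i).IsHomogeneous d) ∧
      p = ∑ i, b i * pderiv i f := by
  obtain ⟨m, rfl⟩ : ∃ k, m = k + 2 := ⟨m - 2, by lia⟩
  have he : ∀ i, (pderiv i f).IsHomogeneous (m + 1) := fun i => hf.homogeneous.pderiv
  have h0 : ∀ x, (∀ i, eval x (pderiv i f) = 0) → x = 0 := by
    intro x hx
    by_contra hx0
    have hE := congrArg (eval x) hf.homogeneous.sum_X_mul_pderiv
    have hfx : eval x f = 0 := by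
      have h1 : ((m + 2 : ℕ) : ℂ) ≠ 0 := by exact_mod_cast (m + 1).succ_ne_zero
      simp only [map_sum, map_mul, hx, mul_zero, Finset.sum_const_zero,
        nsmul_eq_mul, map_natCast] at hE
      exact (mul_eq_zero.mp hE.symm).resolve_left h1
    obtain ⟨i, hi⟩ := hf.smooth x hx0 hfx
    exact hi (hx i)
  have hmem := (isRegularFamily_and_forall_mem_span (fun i => pderiv i f) (fun _ => m) he h0).2
    (d + (m + 1)) (by simpa using hd) p hp
  obtain ⟨c, hc⟩ := Ideal.mem_span_range_iff_exists_fun.mp hmem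
  refine ⟨fun i => homogeneousComponent d (c i), fun i => homogeneousComponent_isHomogeneous _ _, ?_⟩
  have h2 := congrArg (homogeneousComponent (d + (m + 1))) hc
  rw [map_sum, homogeneousComponent_eq_self (show p.IsHomogeneous (d + (m + 1)) from hp)] at h2
  rw [← h2]
  refine Finset.sum_congr rfl fun i _ => ?_
  rw [homogeneousComponent_mul_of_isHomogeneous _ (he i), if_pos (by lia), Nat.add_sub_cancel]

end Forms

/-! ### Weighted norms of power series -/

section Series

open scoped NNReal ENNReal Topology
open Filter MvPowerSeries

variable {n : ℕ}

/-- The weighted `ℓ¹` norm `∑ |f_a| r ^ |a|` of a power series, possibly infinite. -/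
noncomputable def wnorm (r : ℝ≥0) (f : MvPowerSeries (Fin n) ℂ) : ℝ≥0∞ :=
  ∑' a : Fin n →₀ ℕ, ((‖coeff a f‖₊ * r ^ a.degree : ℝ≥0) : ℝ≥0∞)

theorem isConvergent_iff {f : MvPowerSeries (Fin n) ℂ} :
    IsConvergent f ↔ ∃ r : ℝ≥0, 0 < r ∧ wnorm r f ≠ ∞ := by
  constructor
  · rintro ⟨r, hr, h⟩
    refine ⟨⟨r, hr.le⟩, hr, ENNReal.tsum_coe_ne_top_iff_summable.mpr ?_⟩
    rw [← NNReal.summable_coe]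
    exact h
  · rintro ⟨r, hr, h⟩
    refine ⟨r, hr, ?_⟩
    have := NNReal.summable_coe.mpr (ENNReal.tsum_coe_ne_top_iff_summable.mp h)
    exact this

theorem wnorm_zero (r : ℝ≥0) : wnorm r (0 : MvPowerSeries (Fin n) ℂ) = 0 := by
  simp [wnorm]

theorem wnorm_neg (r : ℝ≥0) (f : MvPowerSeries (Fin n) ℂ) : wnorm r (-f) = wnorm r f := by
  simp [wnorm]

theorem wnorm_add_le (r : ℝ≥0) (f g : MvPowerSeries (Fin n) ℂ) :
    wnorm r (f + g) ≤ wnorm r f + wnorm r g := by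
  rw [wnorm, wnorm, wnorm, ← ENNReal.tsum_add]
  refine ENNReal.tsum_le_tsum fun a => ?_
  rw [← ENNReal.coe_add, ENNReal.coe_le_coe, ← add_mul, map_add]
  gcongr
  exact nnnorm_add_le _ _

theorem wnorm_sub_le (r : ℝ≥0) (f g : MvPowerSeries (Fin n) ℂ) :
    wnorm r (f - g) ≤ wnorm r f + wnorm r g := by
  rw [sub_eq_add_neg, ← wnorm_neg r g]
  exact wnorm_add_le _ _ _

theorem wnorm_sum_le {ι : Type*} (r : ℝ≥0) (s : Finset ι) (f : ι → MvPowerSeries (Fin n) ℂ) :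
    wnorm r (∑ i ∈ s, f i) ≤ ∑ i ∈ s, wnorm r (f i) :=
  Finset.le_sum_of_subadditive _ (wnorm_zero r).le (wnorm_add_le r) s f

theorem wnorm_smul_le (r : ℝ≥0) (c : ℂ) (f : MvPowerSeries (Fin n) ℂ) :
    wnorm r (c • f) ≤ ‖c‖₊ * wnorm r f := by
  rw [wnorm, wnorm, ← ENNReal.tsum_mul_left]
  refine ENNReal.tsum_le_tsum fun a => le_of_eq ?_
  rw [← ENNReal.coe_mul, coeff_smul, nnnorm_mul, mul_assoc]

theorem wnorm_mul_le (r : ℝ≥0) (f g : MvPowerSeries (Fin n) ℂ) :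
    wnorm r (f * g) ≤ wnorm r f * wnorm r g := by
  let F : MvPowerSeries (Fin n) ℂ → (Fin n →₀ ℕ) → ℝ≥0∞ := fun f a =>
    ((‖coeff a f‖₊ * r ^ a.degree : ℝ≥0) : ℝ≥0∞)
  calc wnorm r (f * g)
      ≤ ∑' a, ∑ kl ∈ Finset.HasAntidiagonal.antidiagonal a, F f kl.1 * F g kl.2 := by
        refine ENNReal.tsum_le_tsum fun a => ?_
        simp only [F, ← ENNReal.coe_mul]
        rw [← ENNReal.ofNNReal_finsetSum, ENNReal.coe_le_coe, coeff_mul]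
        refine (mul_le_mul_left (nnnorm_sum_le _ _) _).trans ?_
        rw [Finset.sum_mul]
        refine Finset.sum_le_sum fun kl hkl => le_of_eq ?_
        have hd : a.degree = kl.1.degree + kl.2.degree := by
          rw [← map_add, Finset.HasAntidiagonal.mem_antidiagonal.mp hkl]
        rw [nnnorm_mul, hd, pow_add, mul_mul_mul_comm]
    _ = ∑' a, ∑' kl : Finset.HasAntidiagonal.antidiagonal a, F f kl.1.1 * F g kl.1.2 := by
        refine tsum_congr fun a => ?_
        rw [← Finset.tsum_subtype]
    _ = ∑' kl : (Fin n →₀ ℕ) × (Fin n →₀ ℕ), F f kl.1 * F g kl.2 := by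
        rw [← ENNReal.tsum_sigma' fun x : Σ a, Finset.HasAntidiagonal.antidiagonal a =>
          F f x.2.1.1 * F g x.2.1.2]
        exact Finset.HasAntidiagonal.sigmaAntidiagonalEquivProd.tsum_eq
          fun kl : (Fin n →₀ ℕ) × (Fin n →₀ ℕ) => F f kl.1 * F g kl.2
    _ = wnorm r f * wnorm r g := by
        rw [ENNReal.tsum_prod']
        simp_rw [ENNReal.tsum_mul_left, ENNReal.tsum_mul_right]
        rfl

theorem wnorm_monomial (r : ℝ≥0) (a : Fin n →₀ ℕ) (c : ℂ) :
    wnorm r (monomial a c) = ((‖c‖₊ * r ^ a.degree : ℝ≥0) : ℝ≥0∞) := by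
  rw [wnorm, tsum_eq_single a]
  · rw [coeff_monomial_same]
  · intro b hb
    rw [coeff_monomial_ne hb]
    simp

theorem wnorm_X (r : ℝ≥0) (i : Fin n) : wnorm r (X i : MvPowerSeries (Fin n) ℂ) = r := by
  rw [X, wnorm_monomial]; simp

theorem wnorm_one (r : ℝ≥0) : wnorm r (1 : MvPowerSeries (Fin n) ℂ) = 1 := by
  rw [← monomial_zero_one, wnorm_monomial]; simp

theorem wnorm_coe_of_isHomogeneous {p : MvPolynomial (Fin n) ℂ} {d : ℕ} (hp : p.IsHomogeneous d)
    (r : ℝ≥0) : wnorm r (p : MvPowerSeries (Fin n) ℂ) =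
      r ^ d * wnorm 1 (p : MvPowerSeries (Fin n) ℂ) := by
  rw [wnorm, wnorm, ← ENNReal.tsum_mul_left]
  refine tsum_congr fun a => ?_
  rw [MvPolynomial.coeff_coe]
  by_cases h : a.degree = d
  · subst h; push_cast; ring
  · simp [hp.coeff_eq_zero h]

theorem wnorm_one_coe_ne_top (p : MvPolynomial (Fin n) ℂ) :
    wnorm 1 (p : MvPowerSeries (Fin n) ℂ) ≠ ∞ := by
  refine ENNReal.tsum_coe_ne_top_iff_summable.mpr
    (summable_of_hasFiniteSupport (p.support.finite_toSet.subset fun a ha => ?_))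
  simpa [MvPolynomial.coeff_coe] using ha

/-! ### The order filtration -/

/-- The ideal of power series of order at least `d`. -/
def orderIdeal (n d : ℕ) : Ideal (MvPowerSeries (Fin n) ℂ) where
  carrier := {f | ∀ a : Fin n →₀ ℕ, a.degree < d → coeff a f = 0}
  add_mem' hf hg a ha := by rw [map_add, hf a ha, hg a ha, add_zero]
  zero_mem' a _ := by simp
  smul_mem' c f hf a ha := by
    rw [smul_eq_mul, coeff_mul]
    refine Finset.sum_eq_zero fun kl hkl => ?_
    have hd : a.degree = kl.1.degree + kl.2.degree := by
      rw [← map_add, Finset.HasAntidiagonal.mem_antidiagonal.mp hkl]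
    rw [hf kl.2 (by lia), mul_zero]

theorem mem_orderIdeal {d : ℕ} {f : MvPowerSeries (Fin n) ℂ} :
    f ∈ orderIdeal n d ↔ ∀ a : Fin n →₀ ℕ, a.degree < d → coeff a f = 0 := Iff.rfl

theorem mem_orderIdeal_iff_le_order {d : ℕ} {f : MvPowerSeries (Fin n) ℂ} :
    f ∈ orderIdeal n d ↔ (d : ℕ∞) ≤ f.order := by
  constructor
  · intro h
    exact nat_le_order h
  · intro h a ha
    exact coeff_of_lt_order (lt_of_lt_of_le (by exact_mod_cast ha) h)

theorem orderIdeal_anti {d e : ℕ} (h : d ≤ e) : orderIdeal n e ≤ orderIdeal n d :=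
  fun _ hf a ha => hf a (ha.trans_le h)

theorem mul_mem_orderIdeal {d e : ℕ} {f g : MvPowerSeries (Fin n) ℂ} (hf : f ∈ orderIdeal n d)
    (hg : g ∈ orderIdeal n e) : f * g ∈ orderIdeal n (d + e) := by
  intro a ha
  rw [coeff_mul]
  refine Finset.sum_eq_zero fun kl hkl => ?_
  have hd : a.degree = kl.1.degree + kl.2.degree := by
    rw [← map_add, Finset.HasAntidiagonal.mem_antidiagonal.mp hkl]
  rcases lt_or_ge kl.1.degree d with h | h
  · rw [hf kl.1 h, zero_mul]
  · rw [hg kl.2 (by lia), mul_zero]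

theorem X_mem_orderIdeal (i : Fin n) : (X i : MvPowerSeries (Fin n) ℂ) ∈ orderIdeal n 1 := by
  intro a ha
  have : a = 0 := (Finsupp.degree_eq_zero_iff a).mp (by lia)
  subst this
  simp

theorem coe_mem_orderIdeal {p : MvPolynomial (Fin n) ℂ} {d : ℕ} (hp : p.IsHomogeneous d) :
    (p : MvPowerSeries (Fin n) ℂ) ∈ orderIdeal n d := by
  intro a ha
  rw [MvPolynomial.coeff_coe, hp.coeff_eq_zero ha.ne]

/-- Power series of order greater than `k` have norm `o(r ^ k)`. -/
theorem eventually_wnorm_le {k : ℕ} {f : MvPowerSeries (Fin n) ℂ} (hf : IsConvergent f)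
    (hk : f ∈ orderIdeal n (k + 1)) {ε : ℝ≥0} (hε : 0 < ε) :
    ∀ᶠ r in 𝓝[>] (0 : ℝ≥0), wnorm r f ≤ ε * r ^ k := by
  obtain ⟨s, hs, hfs⟩ := isConvergent_iff.mp hf
  obtain ⟨M, hM⟩ : ∃ M : ℝ≥0, wnorm s f = M := ⟨_, (ENNReal.coe_toNNReal hfs).symm⟩
  have key : ∀ r ≤ s, wnorm r f * s ^ (k + 1) ≤ r ^ (k + 1) * M := by
    intro r hr
    rw [← hM, wnorm, wnorm, ← ENNReal.tsum_mul_left, ← ENNReal.tsum_mul_right]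
    refine ENNReal.tsum_le_tsum fun a => ?_
    norm_cast
    rcases lt_or_ge a.degree (k + 1) with h | h
    · rw [hk a h]; simp
    · obtain ⟨j, hj⟩ := Nat.exists_eq_add_of_le h
      rw [hj, pow_add r (k + 1) j, pow_add s (k + 1) j]
      calc ‖coeff a f‖₊ * (r ^ (k + 1) * r ^ j) * s ^ (k + 1)
          ≤ ‖coeff a f‖₊ * (r ^ (k + 1) * s ^ j) * s ^ (k + 1) := by gcongr
        _ = r ^ (k + 1) * (‖coeff a f‖₊ * (s ^ (k + 1) * s ^ j)) := by ring
  have hδ : 0 < min s (ε * s ^ (k + 1) / (M + 1)) := by positivity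
  filter_upwards [Ioo_mem_nhdsGT hδ] with r hr
  have hrs : r ≤ s := hr.2.le.trans (min_le_left _ _)
  have hr2 : r * (M + 1) ≤ ε * s ^ (k + 1) := by
    have := hr.2.le.trans (min_le_right _ _)
    rwa [le_div_iff₀ (by positivity)] at this
  have hs0 : ((s ^ (k + 1) : ℝ≥0) : ℝ≥0∞) ≠ 0 := by
    rw [ENNReal.coe_ne_zero]; positivity
  rw [← ENNReal.mul_le_mul_iff_left hs0 ENNReal.coe_ne_top]
  push_cast
  refine (key r hrs).trans ?_
  norm_cast
  calc r ^ (k + 1) * M ≤ r ^ k * (r * (M + 1)) := by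
        rw [pow_succ, mul_assoc]; gcongr; exact le_self_add
    _ ≤ r ^ k * (ε * s ^ (k + 1)) := by gcongr
    _ = ε * r ^ k * s ^ (k + 1) := by ring

/-! ### Fixed points of maps raising the order -/

/-- A self-map of `n`-tuples of power series that raises the order of differences has a fixed point,
and the fixed point satisfies every norm bound that the map preserves. -/
theorem exists_fixedPoint {T : (Fin n → MvPowerSeries (Fin n) ℂ) → Fin n → MvPowerSeries (Fin n) ℂ}
    {s : ℕ} {r : ℝ≥0} {ρ : ℝ≥0∞}
    (hT : ∀ u, (∀ i, u i ∈ orderIdeal n s) → ∀ i, T u i ∈ orderIdeal n s)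
    (hd : ∀ u v d, (∀ i, u i ∈ orderIdeal n s) → (∀ i, v i ∈ orderIdeal n s) → s ≤ d →
      (∀ i, u i - v i ∈ orderIdeal n d) → ∀ i, T u i - T v i ∈ orderIdeal n (d + 1))
    (hN : ∀ u, (∀ i, u i ∈ orderIdeal n s) → (∀ i, wnorm r (u i) ≤ ρ) → ∀ i, wnorm r (T u i) ≤ ρ) :
    ∃ u, (∀ i, u i ∈ orderIdeal n s) ∧ (∀ i, wnorm r (u i) ≤ ρ) ∧ T u = u := by
  let U : ℕ → Fin n → MvPowerSeries (Fin n) ℂ := fun k => T^[k] 0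
  have hU1 : ∀ k, U (k + 1) = T (U k) := fun k => Function.iterate_succ_apply' T k 0
  have hUs : ∀ k i, U k i ∈ orderIdeal n s := by
    intro k
    induction k with
    | zero => exact fun i => Submodule.zero_mem _
    | succ k ih => rw [hU1]; exact hT _ ih
  have hUN : ∀ k i, wnorm r (U k i) ≤ ρ := by
    intro k
    induction k with
    | zero => exact fun i => (wnorm_zero r).trans_le (zero_le)
    | succ k ih => rw [hU1]; exact hN _ (hUs k) ih
  have hstep : ∀ k i, U (k + 1) i - U k i ∈ orderIdeal n (s + k) := by
    intro k
    induction k with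
    | zero => exact fun i => sub_mem (hUs _ i) (hUs _ i)
    | succ k ih =>
      rw [hU1 (k + 1), hU1 k]
      rw [hU1 k] at ih
      exact hd _ _ _ (hU1 k ▸ hUs (k + 1)) (hUs k) (by lia) ih
  have hdiff : ∀ k j i, U (k + j) i - U k i ∈ orderIdeal n (s + k) := by
    intro k j i
    induction j with
    | zero => simp
    | succ j ih =>
      rw [← sub_add_sub_cancel _ (U (k + j) i)]
      exact add_mem (orderIdeal_anti (by lia) (hstep (k + j) i)) ih
  let u : Fin n → MvPowerSeries (Fin n) ℂ := fun i a => coeff a (U (a.degree + 1) i)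
  have hu : ∀ k i, u i - U k i ∈ orderIdeal n (s + k) := by
    intro k i a ha
    change coeff a (U (a.degree + 1) i) - coeff a (U k i) = 0
    rcases le_total k (a.degree + 1) with h | h
    · obtain ⟨j, hj⟩ := Nat.exists_eq_add_of_le h
      rw [hj, ← map_sub]
      exact hdiff k j i a ha
    · obtain ⟨j, rfl⟩ := Nat.exists_eq_add_of_le h
      rw [← neg_sub, ← map_sub, hdiff (a.degree + 1) j i a (by lia), neg_zero]
  have hus : ∀ i, u i ∈ orderIdeal n s := fun i => by
    have := hu 0 i
    simpa [U] using this
  refine ⟨u, hus, fun i => ?_, ?_⟩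
  · rw [wnorm, ENNReal.tsum_eq_iSup_sum]
    refine iSup_le fun t => ?_
    refine le_trans (le_of_eq ?_) ((ENNReal.sum_le_tsum t).trans (hUN (t.sup Finsupp.degree + 1) i))
    refine Finset.sum_congr rfl fun a ha => ?_
    have h1 := hu (t.sup Finsupp.degree + 1) i a
      (by have := Finset.le_sup (f := Finsupp.degree) ha; lia)
    rw [map_sub, sub_eq_zero] at h1
    rw [h1]
  · funext i
    ext a
    rw [← sub_eq_zero, ← map_sub]
    refine (?_ : T u i - u i ∈ orderIdeal n (s + (a.degree + 1))) a (by lia)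
    rw [← sub_sub_sub_cancel_right _ _ (U (a.degree + 1) i)]
    refine sub_mem ?_ (hu _ i)
    rw [hU1, ← add_assoc]
    exact hd _ _ _ hus (hUs _) (by lia) (hu _) i

/-! ### Taylor expansion of order two -/

/-- Induction on exponents of monomials, one variable at a time. -/
theorem exponent_induction {motive : (Fin n →₀ ℕ) → Prop} (zero : motive 0)
    (add : ∀ a i, motive a → motive (a + Finsupp.single i 1)) (a : Fin n →₀ ℕ) : motive a := by
  induction h : a.degree generalizing a with
  | zero => rwa [(Finsupp.degree_eq_zero_iff a).mp h]
  | succ d ih =>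
    obtain ⟨i, hi⟩ : ∃ i, a i ≠ 0 := by
      by_contra! h0
      have : a = 0 := Finsupp.ext h0
      simp [this] at h
    have ha : a = a - Finsupp.single i 1 + Finsupp.single i 1 :=
      (tsub_add_cancel_of_le (Finsupp.single_le_iff.mpr (Nat.one_le_iff_ne_zero.mpr hi))).symm
    rw [ha]
    refine add _ i (ih _ ?_)
    rw [ha, map_add, Finsupp.degree_single] at h
    lia

/-- The increment `p (x + u) - p (x)`. -/
noncomputable def increment (u : Fin n → MvPowerSeries (Fin n) ℂ) :
    MvPolynomial (Fin n) ℂ →ₗ[ℂ] MvPowerSeries (Fin n) ℂ :=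
  (MvPolynomial.aeval fun i => X i + u i).toLinearMap -
    (MvPolynomial.coeToMvPowerSeries.algHom ℂ).toLinearMap

/-- The second order Taylor remainder `p (x + u) - p (x) - ∑ i, u i * ∂p/∂x_i (x)`. -/
noncomputable def taylorRemainder (u : Fin n → MvPowerSeries (Fin n) ℂ) :
    MvPolynomial (Fin n) ℂ →ₗ[ℂ] MvPowerSeries (Fin n) ℂ :=
  increment u - ∑ i, (LinearMap.mulLeft ℂ (u i)) ∘ₗ
    (MvPolynomial.coeToMvPowerSeries.algHom ℂ).toLinearMap ∘ₗ (MvPolynomial.pderiv i).toLinearMap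

theorem increment_apply (u : Fin n → MvPowerSeries (Fin n) ℂ) (p : MvPolynomial (Fin n) ℂ) :
    increment u p = MvPolynomial.aeval (fun i => X i + u i) p - (p : MvPowerSeries (Fin n) ℂ) := by
  simp [increment]

theorem taylorRemainder_apply (u : Fin n → MvPowerSeries (Fin n) ℂ) (p : MvPolynomial (Fin n) ℂ) :
    taylorRemainder u p = increment u p -
      ∑ i, u i * (MvPolynomial.pderiv i p : MvPowerSeries (Fin n) ℂ) := by
  simp [taylorRemainder]

theorem increment_mul_X (u : Fin n → MvPowerSeries (Fin n) ℂ) (p : MvPolynomial (Fin n) ℂ)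
    (i : Fin n) : increment u (p * MvPolynomial.X i) =
      increment u p * (X i + u i) + (p : MvPowerSeries (Fin n) ℂ) * u i := by
  simp only [increment_apply, map_mul, MvPolynomial.aeval_X, MvPolynomial.coe_mul,
    MvPolynomial.coe_X]
  ring

theorem taylorRemainder_mul_X (u : Fin n → MvPowerSeries (Fin n) ℂ) (p : MvPolynomial (Fin n) ℂ)
    (i : Fin n) : taylorRemainder u (p * MvPolynomial.X i) =
      taylorRemainder u p * X i + u i * increment u p := by
  have h : ∀ j, u j * (MvPolynomial.pderiv j (p * MvPolynomial.X i) : MvPowerSeries (Fin n) ℂ) =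
      u j * (MvPolynomial.pderiv j p : MvPowerSeries (Fin n) ℂ) * X i +
        if i = j then u j * (p : MvPowerSeries (Fin n) ℂ) else 0 := by
    intro j
    rw [Derivation.leibniz, MvPolynomial.pderiv_X]
    by_cases hij : i = j
    · subst hij
      simp only [Pi.single_eq_same, smul_eq_mul, MvPolynomial.coe_add, MvPolynomial.coe_mul,
        MvPolynomial.coe_X, MvPolynomial.coe_one, if_true]
      ring
    · simp only [Pi.single_eq_of_ne' (Ne.symm hij), smul_eq_mul, MvPolynomial.coe_add,
        MvPolynomial.coe_mul, MvPolynomial.coe_X, MvPolynomial.coe_zero, if_neg hij]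
      ring
  rw [taylorRemainder_apply, taylorRemainder_apply, increment_mul_X, Finset.sum_congr rfl
    fun j _ => h j, Finset.sum_add_distrib, Finset.sum_ite_eq, if_pos (Finset.mem_univ i),
    ← Finset.sum_mul]
  ring

theorem monomial_add_single_one (a : Fin n →₀ ℕ) (i : Fin n) :
    (MvPolynomial.monomial (a + Finsupp.single i 1) (1 : ℂ)) =
      MvPolynomial.monomial a 1 * MvPolynomial.X i := by
  rw [MvPolynomial.monomial_add_single, pow_one]

theorem increment_zero (p : MvPolynomial (Fin n) ℂ) :
    increment (0 : Fin n → MvPowerSeries (Fin n) ℂ) p = 0 := by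
  have h : MvPolynomial.aeval (fun i => X i + (0 : Fin n → MvPowerSeries (Fin n) ℂ) i) =
      MvPolynomial.coeToMvPowerSeries.algHom ℂ :=
    MvPolynomial.algHom_ext (R := ℂ) fun i => by simp
  rw [increment, h, sub_self, LinearMap.zero_apply]

theorem increment_one (u : Fin n → MvPowerSeries (Fin n) ℂ) : increment u 1 = 0 := by
  simp [increment_apply]

theorem taylorRemainder_one (u : Fin n → MvPowerSeries (Fin n) ℂ) : taylorRemainder u 1 = 0 := by
  simp [taylorRemainder_apply, increment_one]

section Norm

variable {u : Fin n → MvPowerSeries (Fin n) ℂ} {r ρ : ℝ≥0}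

theorem wnorm_increment_monomial_le (hρ : ρ ≤ r) (hu : ∀ i, wnorm r (u i) ≤ ρ) (a : Fin n →₀ ℕ) :
    wnorm r (increment u (MvPolynomial.monomial a 1)) * r ≤ 3 ^ a.degree * r ^ a.degree * ρ := by
  induction a using exponent_induction with
  | zero => simp [increment_one, wnorm_zero]
  | add a i ih =>
    rw [monomial_add_single_one, increment_mul_X, map_add, Finsupp.degree_single]
    have h1 : wnorm r (X i + u i) ≤ 2 * r := by
      refine (wnorm_add_le _ _ _).trans ?_
      rw [wnorm_X, two_mul]
      gcongr
      exact (hu i).trans (by exact_mod_cast hρ)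
    have h2 : wnorm r ((MvPolynomial.monomial a (1 : ℂ) : MvPolynomial (Fin n) ℂ) :
        MvPowerSeries (Fin n) ℂ) ≤ r ^ a.degree := by
      rw [MvPolynomial.coe_monomial, wnorm_monomial]; simp
    set k := a.degree
    set P := increment u (MvPolynomial.monomial a 1)
    calc _ ≤ (wnorm r P * (2 * r) + r ^ k * ρ) * r := by
          gcongr
          refine (wnorm_add_le _ _ _).trans (add_le_add ?_ ?_)
          · exact (wnorm_mul_le _ _ _).trans (by gcongr)
          · exact (wnorm_mul_le _ _ _).trans (by gcongr; exact hu i)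
      _ = (wnorm r P * r) * (2 * r) + r ^ k * ρ * r := by ring
      _ ≤ (3 ^ k * r ^ k * ρ) * (2 * r) + 3 ^ k * (r ^ k * ρ * r) := by
          refine add_le_add (by gcongr) (le_mul_of_one_le_left zero_le (one_le_pow₀ ?_))
          norm_num
      _ = 3 ^ (k + 1) * r ^ (k + 1) * ρ := by ring

theorem wnorm_taylorRemainder_monomial_le (hρ : ρ ≤ r) (hu : ∀ i, wnorm r (u i) ≤ ρ)
    (a : Fin n →₀ ℕ) : wnorm r (taylorRemainder u (MvPolynomial.monomial a 1)) * r ^ 2 ≤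
      3 ^ a.degree * r ^ a.degree * ρ ^ 2 := by
  induction a using exponent_induction with
  | zero => simp [taylorRemainder_one, wnorm_zero]
  | add a i ih =>
    rw [monomial_add_single_one, taylorRemainder_mul_X, map_add, Finsupp.degree_single]
    have hP := wnorm_increment_monomial_le hρ hu a
    set k := a.degree
    set P := increment u (MvPolynomial.monomial a 1)
    set Q := taylorRemainder u (MvPolynomial.monomial a 1)
    calc _ ≤ (wnorm r Q * r + ρ * wnorm r P) * r ^ 2 := by
          gcongr
          refine (wnorm_add_le _ _ _).trans (add_le_add ?_ ?_)
          · exact (wnorm_mul_le _ _ _).trans (by rw [wnorm_X])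
          · exact (wnorm_mul_le _ _ _).trans (by gcongr; exact hu i)
      _ = (wnorm r Q * r ^ 2) * r + ρ * (wnorm r P * r) * r := by ring
      _ ≤ (3 ^ k * r ^ k * ρ ^ 2) * r + ρ * (3 ^ k * r ^ k * ρ) * r := by gcongr
      _ = (2 * 3 ^ k) * r ^ (k + 1) * ρ ^ 2 := by ring
      _ ≤ (3 * 3 ^ k) * r ^ (k + 1) * ρ ^ 2 := by
          gcongr
          norm_num
      _ = 3 ^ (k + 1) * r ^ (k + 1) * ρ ^ 2 := by ring

/-- Quadratic bound for the Taylor remainder of a form of degree `m`. -/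
theorem exists_wnorm_taylorRemainder_le {f : MvPolynomial (Fin n) ℂ} {m : ℕ}
    (hf : f.IsHomogeneous m) : ∃ C : ℝ≥0, ∀ (r ρ : ℝ≥0) (u : Fin n → MvPowerSeries (Fin n) ℂ),
      ρ ≤ r → (∀ i, wnorm r (u i) ≤ ρ) →
        wnorm r (taylorRemainder u f) * r ^ 2 ≤ C * r ^ m * ρ ^ 2 := by
  refine ⟨∑ a ∈ f.support, ‖f.coeff a‖₊ * 3 ^ m, fun r ρ u hρ hu => ?_⟩
  have hsum : taylorRemainder u f =
      ∑ a ∈ f.support, f.coeff a • taylorRemainder u (MvPolynomial.monomial a 1) := by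
    conv_lhs => rw [MvPolynomial.as_sum f, map_sum]
    refine Finset.sum_congr rfl fun a _ => ?_
    rw [← map_smul, MvPolynomial.smul_monomial, smul_eq_mul, mul_one]
  rw [hsum]
  refine (mul_le_mul_left (wnorm_sum_le _ _ _) _).trans ?_
  rw [ENNReal.ofNNReal_finsetSum, Finset.sum_mul, Finset.sum_mul, Finset.sum_mul]
  refine Finset.sum_le_sum fun a ha => ?_
  have hdeg : a.degree = m := (hf.degree_eq_sum_deg_support ha).symm
  have h1 := wnorm_taylorRemainder_monomial_le hρ hu a
  rw [hdeg] at h1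
  calc _ ≤ ‖f.coeff a‖₊ * wnorm r (taylorRemainder u (MvPolynomial.monomial a 1)) * r ^ 2 := by
        gcongr
        exact wnorm_smul_le _ _ _
    _ = ‖f.coeff a‖₊ * (wnorm r (taylorRemainder u (MvPolynomial.monomial a 1)) * r ^ 2) := by ring
    _ ≤ ‖f.coeff a‖₊ * (3 ^ m * r ^ m * ρ ^ 2) := by gcongr
    _ = _ := by push_cast; ring

end Norm

section Order

variable {u v : Fin n → MvPowerSeries (Fin n) ℂ} {d : ℕ}

/-- The shift by one in the degree avoids truncated subtraction: monomials of degree `k` map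
congruent arguments to values congruent modulo order `d + k - 1`. -/
theorem increment_monomial_sub_mem (hu : ∀ i, u i ∈ orderIdeal n 1) (hv : ∀ i, v i ∈ orderIdeal n 1)
    (hd : ∀ i, u i - v i ∈ orderIdeal n (d + 1)) (a : Fin n →₀ ℕ) :
    increment u (MvPolynomial.monomial a 1) - increment v (MvPolynomial.monomial a 1) ∈
      orderIdeal n (d + a.degree) := by
  induction a using exponent_induction with
  | zero => simp [increment_one]
  | add a i ih =>
    rw [monomial_add_single_one, map_add, Finsupp.degree_single]
    have h : increment u (MvPolynomial.monomial a 1 * MvPolynomial.X i) -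
        increment v (MvPolynomial.monomial a 1 * MvPolynomial.X i) =
        (increment u (MvPolynomial.monomial a 1) - increment v (MvPolynomial.monomial a 1)) *
          (X i + u i) + MvPolynomial.aeval (fun i => X i + v i) (MvPolynomial.monomial a (1 : ℂ)) *
            (u i - v i) := by
      simp only [increment_apply, map_mul, MvPolynomial.aeval_X, MvPolynomial.coe_mul]
      ring
    have hw : ∀ a, MvPolynomial.aeval (fun i => X i + v i) (MvPolynomial.monomial a (1 : ℂ)) ∈
        orderIdeal n a.degree := by
      intro a
      induction a using exponent_induction with
      | zero => intro b hb; simp at hb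
      | add a i ih =>
        rw [monomial_add_single_one, map_mul, MvPolynomial.aeval_X, map_add, Finsupp.degree_single]
        exact mul_mem_orderIdeal ih (add_mem (X_mem_orderIdeal i) (hv i))
    rw [h]
    refine add_mem ?_ ?_
    · rw [← add_assoc]
      exact mul_mem_orderIdeal ih (add_mem (X_mem_orderIdeal i) (hu i))
    · have := mul_mem_orderIdeal (hw a) (hd i)
      rwa [add_left_comm] at this

theorem taylorRemainder_monomial_sub_mem (hu : ∀ i, u i ∈ orderIdeal n 2)
    (hv : ∀ i, v i ∈ orderIdeal n 2) (hd : ∀ i, u i - v i ∈ orderIdeal n (d + 1))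
    (a : Fin n →₀ ℕ) :
    taylorRemainder u (MvPolynomial.monomial a 1) - taylorRemainder v (MvPolynomial.monomial a 1) ∈
      orderIdeal n (d + 1 + a.degree) := by
  have h21 : orderIdeal n 2 ≤ orderIdeal n 1 := orderIdeal_anti one_le_two
  induction a using exponent_induction with
  | zero => simp [taylorRemainder_one]
  | add a i ih =>
    rw [monomial_add_single_one, map_add, Finsupp.degree_single, taylorRemainder_mul_X,
      taylorRemainder_mul_X]
    have hP := increment_monomial_sub_mem (fun i => h21 (hu i)) (fun i => h21 (hv i)) hd a
    have hP0 : increment u (MvPolynomial.monomial a 1) ∈ orderIdeal n (1 + a.degree) := by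
      have := increment_monomial_sub_mem (u := u) (v := 0) (d := 1) (fun i => h21 (hu i))
        (fun i => Submodule.zero_mem _) (fun i => by simpa using hu i) a
      rwa [increment_zero, sub_zero] at this
    set P := increment u (MvPolynomial.monomial a 1)
    set P' := increment v (MvPolynomial.monomial a 1)
    set Q := taylorRemainder u (MvPolynomial.monomial a 1)
    set Q' := taylorRemainder v (MvPolynomial.monomial a 1)
    have h : Q * X i + u i * P - (Q' * X i + v i * P') =
        (Q - Q') * X i + (u i - v i) * P + v i * (P - P') := by ring
    rw [h]
    refine add_mem (add_mem ?_ ?_) ?_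
    · rw [← add_assoc]
      exact mul_mem_orderIdeal ih (X_mem_orderIdeal i)
    · exact orderIdeal_anti (by lia) (mul_mem_orderIdeal (hd i) hP0)
    · exact orderIdeal_anti (by lia) (mul_mem_orderIdeal (hv i) hP)

theorem taylorRemainder_sub_mem {f : MvPolynomial (Fin n) ℂ} {m : ℕ} (hf : f.IsHomogeneous m)
    (hu : ∀ i, u i ∈ orderIdeal n 2) (hv : ∀ i, v i ∈ orderIdeal n 2)
    (hd : ∀ i, u i - v i ∈ orderIdeal n (d + 1)) :
    taylorRemainder u f - taylorRemainder v f ∈ orderIdeal n (d + 1 + m) := by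
  have hsum : ∀ u, taylorRemainder u f =
      ∑ a ∈ f.support, f.coeff a • taylorRemainder u (MvPolynomial.monomial a 1) := by
    intro u
    conv_lhs => rw [MvPolynomial.as_sum f, map_sum]
    refine Finset.sum_congr rfl fun a _ => ?_
    rw [← map_smul, MvPolynomial.smul_monomial, smul_eq_mul, mul_one]
  rw [hsum, hsum, ← Finset.sum_sub_distrib]
  refine sum_mem fun a ha => ?_
  rw [← smul_sub, smul_eq_C_mul]
  have h := taylorRemainder_monomial_sub_mem hu hv hd a
  have hdeg : a.degree = m := (hf.degree_eq_sum_deg_support ha).symm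
  rw [hdeg] at h
  exact Ideal.mul_mem_left _ _ h

end Order

/-! ### Division of power series by forms -/

/-- The quotient of the part of `p` assigned to `b` by the monomial with exponent `b`, for an
assignment `c` of exponents to divisors. -/
noncomputable def quotientPart (c : (Fin n →₀ ℕ) → Fin n →₀ ℕ) (b : Fin n →₀ ℕ)
    (p : MvPowerSeries (Fin n) ℂ) : MvPowerSeries (Fin n) ℂ :=
  fun a => if c (a + b) = b then coeff (a + b) p else 0

theorem coeff_quotientPart (c : (Fin n →₀ ℕ) → Fin n →₀ ℕ) (a b : Fin n →₀ ℕ)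
    (p : MvPowerSeries (Fin n) ℂ) :
    coeff a (quotientPart c b p) = if c (a + b) = b then coeff (a + b) p else 0 := rfl

theorem quotientPart_sub (c : (Fin n →₀ ℕ) → Fin n →₀ ℕ) (b : Fin n →₀ ℕ)
    (p q : MvPowerSeries (Fin n) ℂ) :
    quotientPart c b (p - q) = quotientPart c b p - quotientPart c b q := by
  ext a
  simp only [map_sub, coeff_quotientPart]
  split_ifs <;> simp

theorem quotientPart_mem {c : (Fin n →₀ ℕ) → Fin n →₀ ℕ} {b : Fin n →₀ ℕ} {d : ℕ}
    {p : MvPowerSeries (Fin n) ℂ} (hp : p ∈ orderIdeal n (d + b.degree)) :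
    quotientPart c b p ∈ orderIdeal n d := by
  intro a ha
  rw [coeff_quotientPart, hp _ (by rw [map_add]; lia), ite_self]

theorem wnorm_quotientPart_le (c : (Fin n →₀ ℕ) → Fin n →₀ ℕ) (b : Fin n →₀ ℕ)
    (p : MvPowerSeries (Fin n) ℂ) (r : ℝ≥0) :
    r ^ b.degree * wnorm r (quotientPart c b p) ≤ wnorm r p := by
  rw [wnorm, wnorm, ← ENNReal.tsum_mul_left]
  refine le_trans (ENNReal.tsum_le_tsum fun a => ?_)
    (ENNReal.tsum_comp_le_tsum_of_injective (add_left_injective b) _)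
  rw [coeff_quotientPart]
  split_ifs
  · simp only [map_add, pow_add]
    push_cast
    exact le_of_eq (by ring)
  · simp

theorem sum_monomial_mul_quotientPart {c : (Fin n →₀ ℕ) → Fin n →₀ ℕ} {d : ℕ}
    (hc : ∀ a, d ≤ a.degree → c a ≤ a ∧ (c a).degree = d) {p : MvPowerSeries (Fin n) ℂ}
    (hp : p ∈ orderIdeal n d) :
    ∑ b ∈ (Finsupp.finite_of_degree_eq (σ := Fin n) d).toFinset,
      monomial b (1 : ℂ) * quotientPart c b p = p := by
  ext a
  simp only [map_sum, coeff_monomial_mul, one_mul, coeff_quotientPart]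
  by_cases ha : d ≤ a.degree
  · rw [Finset.sum_eq_single (c a)]
    · rw [if_pos (hc a ha).1, tsub_add_cancel_of_le (hc a ha).1, if_pos rfl]
    · intro b _ hb
      split_ifs with h1 h2
      · rw [tsub_add_cancel_of_le h1] at h2
        exact absurd h2.symm hb
      · rfl
      · rfl
    · intro h
      simp [(hc a ha).2] at h
  · rw [hp a (by lia)]
    refine Finset.sum_eq_zero fun b hb => ?_
    rw [if_neg]
    intro h
    have h1 : b.degree = d := by simpa using hb
    have := Finsupp.degree_mono h
    lia

/-- Let every form of degree `s + e` be a combination of the forms `g i` of degree `e`. Then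
division by the `g i` is possible for power series of order at least `s + e`, by an operator that
is additive, lowers orders by `e`, and is bounded. -/
theorem exists_division {s e : ℕ} {g : Fin n → MvPolynomial (Fin n) ℂ}
    (hg : ∀ p : MvPolynomial (Fin n) ℂ, p.IsHomogeneous (s + e) →
      ∃ b : Fin n → MvPolynomial (Fin n) ℂ, (∀ i, (b i).IsHomogeneous s) ∧ p = ∑ i, b i * g i) :
    ∃ (L : MvPowerSeries (Fin n) ℂ → Fin n → MvPowerSeries (Fin n) ℂ) (C : ℝ≥0),
      (∀ p q i, L (p - q) i = L p i - L q i) ∧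
      (∀ p ∈ orderIdeal n (s + e), ∑ i, L p i * (g i : MvPowerSeries (Fin n) ℂ) = p) ∧
      (∀ d, ∀ p ∈ orderIdeal n (d + (s + e)), ∀ i, L p i ∈ orderIdeal n (d + s)) ∧
      (∀ (r : ℝ≥0) p i, r ^ e * wnorm r (L p i) ≤ C * wnorm r p) := by
  have h1 : ∀ b : Fin n →₀ ℕ, ∃ q : Fin n → MvPolynomial (Fin n) ℂ, (∀ i, (q i).IsHomogeneous s) ∧
      (b.degree = s + e → MvPolynomial.monomial b (1 : ℂ) = ∑ i, q i * g i) := by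
    intro b
    by_cases hb : b.degree = s + e
    · obtain ⟨q, hq, hq'⟩ := hg _ (MvPolynomial.isHomogeneous_monomial (1 : ℂ) hb)
      exact ⟨q, hq, fun _ => hq'⟩
    · exact ⟨0, fun _ => MvPolynomial.isHomogeneous_zero _ _ _, fun h => absurd h hb⟩
  choose q hq hq' using h1
  have h2 : ∀ a : Fin n →₀ ℕ, ∃ b, s + e ≤ a.degree → b ≤ a ∧ b.degree = s + e := by
    intro a
    by_cases ha : s + e ≤ a.degree
    · obtain ⟨b, hb⟩ := a.exists_le_degree_eq (s + e) ha
      exact ⟨b, fun _ => hb⟩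
    · exact ⟨0, fun h => absurd h ha⟩
  choose c hc using h2
  set B := (Finsupp.finite_of_degree_eq (σ := Fin n) (s + e)).toFinset
  have hB : ∀ b ∈ B, b.degree = s + e := fun b hb => by simpa [B] using hb
  let N : (Fin n →₀ ℕ) → Fin n → ℝ≥0 := fun b i =>
    (wnorm 1 (q b i : MvPowerSeries (Fin n) ℂ)).toNNReal
  have hN : ∀ b i, (N b i : ℝ≥0∞) = wnorm 1 (q b i : MvPowerSeries (Fin n) ℂ) := fun b i =>
    ENNReal.coe_toNNReal (wnorm_one_coe_ne_top _)
  refine ⟨fun p i => ∑ b ∈ B, quotientPart c b p * (q b i : MvPowerSeries (Fin n) ℂ),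
    ∑ i, ∑ b ∈ B, N b i, ?_, ?_, ?_, ?_⟩
  · intro p p' i
    simp only [quotientPart_sub, sub_mul, Finset.sum_sub_distrib]
  · intro p hp
    simp only [Finset.sum_mul]
    rw [Finset.sum_comm]
    conv_rhs => rw [← sum_monomial_mul_quotientPart hc hp]
    refine Finset.sum_congr rfl fun b hb => ?_
    have h3 := congrArg (fun p : MvPolynomial (Fin n) ℂ => (p : MvPowerSeries (Fin n) ℂ))
      (hq' b (hB b hb))
    simp only [MvPolynomial.coe_monomial] at h3
    rw [h3, ← MvPolynomial.coeToMvPowerSeries.ringHom_apply, map_sum, Finset.sum_mul]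
    refine Finset.sum_congr rfl fun i _ => ?_
    rw [map_mul, MvPolynomial.coeToMvPowerSeries.ringHom_apply,
      MvPolynomial.coeToMvPowerSeries.ringHom_apply]
    ring
  · intro d p hp i
    refine sum_mem fun b hb => mul_mem_orderIdeal (quotientPart_mem ?_) (coe_mem_orderIdeal (hq b i))
    rwa [hB b hb]
  · intro r p i
    calc r ^ e * wnorm r (∑ b ∈ B, quotientPart c b p * (q b i : MvPowerSeries (Fin n) ℂ))
        ≤ r ^ e * ∑ b ∈ B, wnorm r (quotientPart c b p) * (r ^ s * N b i) := by
          gcongr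
          refine (wnorm_sum_le _ _ _).trans (Finset.sum_le_sum fun b _ => ?_)
          rw [hN, ← wnorm_coe_of_isHomogeneous (hq b i)]
          exact wnorm_mul_le _ _ _
      _ = ∑ b ∈ B, (r ^ (s + e) * wnorm r (quotientPart c b p)) * N b i := by
          rw [Finset.mul_sum]
          exact Finset.sum_congr rfl fun b _ => by ring
      _ ≤ ∑ b ∈ B, wnorm r p * N b i := by
          refine Finset.sum_le_sum fun b hb => ?_
          gcongr
          rw [← hB b hb]
          exact wnorm_quotientPart_le c b p r
      _ = (∑ b ∈ B, N b i : ℝ≥0) * wnorm r p := by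
          rw [← Finset.mul_sum, mul_comm, ENNReal.ofNNReal_finsetSum]
      _ ≤ _ := by
          gcongr
          exact Finset.single_le_sum (f := fun i => ∑ b ∈ B, N b i) (fun _ _ => zero_le)
            (Finset.mem_univ i)

/-! ### Solving for the change of coordinates -/

/-- Solving `f (x + u) = f + h`: if every form of degree `s + e` is a combination of the partial
derivatives of the form `f` of degree `e + 1`, then each convergent `h` of order at least `s + e`
is the increment of `f` along a convergent `u` of order at least `s`. The equation reads
`∑ i, u i * ∂f/∂x_i = h - taylorRemainder u f`, so `u` is a fixed point of
`u ↦ L (h - taylorRemainder u f)` with `L` a bounded division operator. -/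
theorem exists_aeval_add_eq {f : MvPolynomial (Fin n) ℂ} {s e : ℕ} (hs : 2 ≤ s)
    (hf : f.IsHomogeneous (e + 1))
    (hg : ∀ p : MvPolynomial (Fin n) ℂ, p.IsHomogeneous (s + e) →
      ∃ b : Fin n → MvPolynomial (Fin n) ℂ, (∀ i, (b i).IsHomogeneous s) ∧
        p = ∑ i, b i * MvPolynomial.pderiv i f)
    {h : MvPowerSeries (Fin n) ℂ} (hh : h ∈ orderIdeal n (s + e)) (hc : IsConvergent h) :
    ∃ u : Fin n → MvPowerSeries (Fin n) ℂ, (∀ i, u i ∈ orderIdeal n s) ∧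
      (∀ i, IsConvergent (u i)) ∧ MvPolynomial.aeval (fun i => X i + u i) f = f + h := by
  obtain ⟨L, CL, hLsub, hLsol, hLord, hLnorm⟩ := exists_division hg
  obtain ⟨CQ, hQ⟩ := exists_wnorm_taylorRemainder_le hf
  -- on the ball of radius `ε * r` the quadratic term `L (taylorRemainder u f)` has norm at most
  -- `ε * r / 2`, and for small `r` so has `L h`
  let ε : ℝ≥0 := 1 / (2 * (CL * CQ + 1))
  have hε0 : 0 < ε := by positivity
  have hε : CL * CQ * ε ≤ 1 / 2 := by
    rw [mul_one_div, div_le_div_iff₀ (by positivity) (by positivity)]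
    rw [one_mul, mul_comm, mul_add]
    exact le_self_add
  have hε1 : ε ≤ 1 := by
    rw [div_le_one (by positivity)]
    calc (1 : ℝ≥0) ≤ 2 * 1 := by norm_num
      _ ≤ 2 * (CL * CQ + 1) := by gcongr; exact le_add_self
  let η : ℝ≥0 := ε / (2 * (CL + 1))
  have hη0 : 0 < η := by positivity
  have hη : CL * η ≤ ε / 2 := by
    rw [mul_div_assoc', div_le_div_iff₀ (by positivity) (by positivity)]
    calc CL * ε * 2 = ε * (2 * CL) := by ring
      _ ≤ ε * (2 * (CL + 1)) := by gcongr; exact le_self_add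
  obtain ⟨r, hrh, hr0⟩ := ((eventually_wnorm_le (k := e + 1) hc
    (orderIdeal_anti (by lia) hh) hη0).and self_mem_nhdsWithin).exists
  have hr0 : 0 < r := hr0
  have h0rem : ∀ d, 2 ≤ d → ∀ u : Fin n → MvPowerSeries (Fin n) ℂ,
      (∀ i, u i ∈ orderIdeal n d) → taylorRemainder u f ∈ orderIdeal n (d + (e + 1)) := by
    intro d hd u hu
    obtain ⟨d, rfl⟩ := Nat.exists_eq_add_of_le' (one_le_two.trans hd)
    have := taylorRemainder_sub_mem (u := u) (v := 0) (d := d) hf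
      (fun i => orderIdeal_anti hd (hu i)) (fun _ => Submodule.zero_mem _)
      (fun i => by simpa using hu i)
    have hz : taylorRemainder (0 : Fin n → MvPowerSeries (Fin n) ℂ) f = 0 := by
      simp [taylorRemainder_apply, increment_zero]
    rwa [hz, sub_zero] at this
  have hmem : ∀ u : Fin n → MvPowerSeries (Fin n) ℂ, (∀ i, u i ∈ orderIdeal n s) →
      h - taylorRemainder u f ∈ orderIdeal n (s + e) := fun u hu =>
    sub_mem hh (orderIdeal_anti (by lia) (h0rem s hs u hu))
  obtain ⟨u, hus, huN, hfix⟩ : ∃ u : Fin n → MvPowerSeries (Fin n) ℂ,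
      (∀ i, u i ∈ orderIdeal n s) ∧ (∀ i, wnorm r (u i) ≤ ((ε * r : ℝ≥0) : ℝ≥0∞)) ∧
        L (h - taylorRemainder u f) = u := by
    refine exists_fixedPoint (T := fun u => L (h - taylorRemainder u f)) ?_ ?_ ?_
    · intro u hu i
      simpa using hLord 0 _ (by simpa using hmem u hu) i
    · intro u v d hu hv hd huv i
      obtain ⟨d, rfl⟩ := Nat.exists_eq_add_of_le' (one_le_two.trans (hs.trans hd))
      obtain ⟨j, hj⟩ := Nat.exists_eq_add_of_le hd
      have h1 := taylorRemainder_sub_mem hf (fun i => orderIdeal_anti hs (hu i))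
        (fun i => orderIdeal_anti hs (hv i)) huv
      rw [show d + 1 + (e + 1) = j + 1 + (s + e) by lia, ← neg_mem_iff, neg_sub] at h1
      rw [← hLsub, sub_sub_sub_cancel_left, show d + 1 + 1 = j + 1 + s by lia]
      exact hLord _ _ h1 i
    · intro u hu hN i
      have h1 := hQ r (ε * r) u (mul_le_of_le_one_left zero_le hε1) hN
      have hr2 : ((r : ℝ≥0∞) ^ 2) ≠ 0 := by positivity
      have h2 : wnorm r (taylorRemainder u f) ≤ ((CQ * r ^ (e + 1) * ε ^ 2 : ℝ≥0) : ℝ≥0∞) := by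
        rw [← ENNReal.mul_le_mul_iff_left hr2 (by finiteness)]
        refine h1.trans (le_of_eq ?_)
        push_cast
        ring
      have hre : ((r : ℝ≥0∞) ^ e) ≠ 0 := by positivity
      rw [← ENNReal.mul_le_mul_iff_right hre (by finiteness)]
      calc (r : ℝ≥0∞) ^ e * wnorm r (L (h - taylorRemainder u f) i)
          ≤ CL * wnorm r (h - taylorRemainder u f) := hLnorm _ _ _
        _ ≤ CL * (η * r ^ (e + 1) + ((CQ * r ^ (e + 1) * ε ^ 2 : ℝ≥0) : ℝ≥0∞)) := by
            gcongr
            exact (wnorm_sub_le _ _ _).trans (add_le_add hrh h2)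
        _ = ((CL * (η * r ^ (e + 1) + CQ * r ^ (e + 1) * ε ^ 2) : ℝ≥0) : ℝ≥0∞) := by push_cast; ring
        _ ≤ ((r ^ e * (ε * r) : ℝ≥0) : ℝ≥0∞) := by
            rw [ENNReal.coe_le_coe]
            calc CL * (η * r ^ (e + 1) + CQ * r ^ (e + 1) * ε ^ 2)
                = (CL * η + (CL * CQ * ε) * ε) * r ^ (e + 1) := by ring
              _ ≤ (ε / 2 + 1 / 2 * ε) * r ^ (e + 1) := by gcongr
              _ = (ε / 2 + ε / 2) * r ^ (e + 1) := by ring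
              _ = r ^ e * (ε * r) := by rw [add_halves]; ring
        _ = _ := by push_cast; ring
  refine ⟨u, hus, fun i => isConvergent_iff.mpr
    ⟨r, hr0, ((huN i).trans_lt ENNReal.coe_lt_top).ne⟩, ?_⟩
  have h1 := hLsol _ (hmem u hus)
  rw [hfix, taylorRemainder_apply, increment_apply] at h1
  linear_combination h1

/-! ### Substitutions tangent to the identity -/

section Substitution

theorem hasSubst_of_mem {w : Fin n → MvPowerSeries (Fin n) ℂ} (hw : ∀ i, w i ∈ orderIdeal n 1) :
    HasSubst w :=
  hasSubst_of_constantCoeff_zero fun i => by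
    rw [← coeff_zero_eq_constantCoeff_apply]
    exact hw i 0 (by simp)

theorem prod_pow_add_single (w : Fin n → MvPowerSeries (Fin n) ℂ) (a : Fin n →₀ ℕ) (i : Fin n) :
    ((a + Finsupp.single i 1).prod fun j e => w j ^ e) = (a.prod fun j e => w j ^ e) * w i := by
  rw [Finsupp.prod_add_index' (fun _ => pow_zero _) (fun _ _ _ => pow_add _ _ _),
    Finsupp.prod_single_index (h := fun j e => w j ^ e) (pow_zero _), pow_one]

theorem wnorm_prod_pow_le {w : Fin n → MvPowerSeries (Fin n) ℂ} {r R : ℝ≥0}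
    (hw : ∀ i, wnorm r (w i) ≤ R) (a : Fin n →₀ ℕ) :
    wnorm r (a.prod fun j e => w j ^ e) ≤ R ^ a.degree := by
  induction a using exponent_induction with
  | zero => simp [wnorm_one]
  | add a i ih =>
    rw [prod_pow_add_single, map_add, Finsupp.degree_single, pow_succ]
    exact (wnorm_mul_le _ _ _).trans (by gcongr; exact hw i)

theorem wnorm_subst_le {w : Fin n → MvPowerSeries (Fin n) ℂ} {r R : ℝ≥0} (hs : HasSubst w)
    (hw : ∀ i, wnorm r (w i) ≤ R) (f : MvPowerSeries (Fin n) ℂ) :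
    wnorm r (subst w f) ≤ wnorm R f := by
  have hcoeff : ∀ e : Fin n →₀ ℕ, (‖coeff e (subst w f)‖₊ : ℝ≥0∞) ≤
      ∑' a, ((‖coeff a f‖₊ * ‖coeff e (a.prod fun j k => w j ^ k)‖₊ : ℝ≥0) : ℝ≥0∞) := by
    intro e
    rw [coeff_subst hs, finsum_eq_sum _ (coeff_subst_finite hs f e)]
    refine le_trans ?_ (ENNReal.sum_le_tsum (coeff_subst_finite hs f e).toFinset)
    rw [← ENNReal.ofNNReal_finsetSum, ENNReal.coe_le_coe]
    refine (nnnorm_sum_le _ _).trans (Finset.sum_le_sum fun a _ => le_of_eq ?_)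
    rw [smul_eq_mul, nnnorm_mul]
  calc wnorm r (subst w f)
      ≤ ∑' e : Fin n →₀ ℕ, ∑' a,
          ((‖coeff a f‖₊ * ‖coeff e (a.prod fun j k => w j ^ k)‖₊ : ℝ≥0) : ℝ≥0∞) *
            r ^ e.degree := by
        refine ENNReal.tsum_le_tsum fun e => ?_
        rw [ENNReal.tsum_mul_right]
        push_cast
        gcongr
        exact_mod_cast hcoeff e
    _ = ∑' a : Fin n →₀ ℕ, ‖coeff a f‖₊ * wnorm r (a.prod fun j k => w j ^ k) := by
        rw [ENNReal.tsum_comm]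
        refine tsum_congr fun a => ?_
        rw [wnorm, ← ENNReal.tsum_mul_left]
        refine tsum_congr fun e => ?_
        push_cast
        ring
    _ ≤ wnorm R f := by
        refine ENNReal.tsum_le_tsum fun a => ?_
        push_cast
        gcongr
        exact wnorm_prod_pow_le hw a

theorem prod_pow_mem {w : Fin n → MvPowerSeries (Fin n) ℂ} (hw : ∀ i, w i ∈ orderIdeal n 1)
    (a : Fin n →₀ ℕ) : (a.prod fun j e => w j ^ e) ∈ orderIdeal n a.degree := by
  induction a using exponent_induction with
  | zero => intro b hb; simp at hb
  | add a i ih =>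
    rw [prod_pow_add_single, map_add, Finsupp.degree_single]
    exact mul_mem_orderIdeal ih (hw i)

theorem prod_pow_sub_mem {w v : Fin n → MvPowerSeries (Fin n) ℂ} {d : ℕ}
    (hw : ∀ i, w i ∈ orderIdeal n 1) (hv : ∀ i, v i ∈ orderIdeal n 1)
    (hd : ∀ i, w i - v i ∈ orderIdeal n (d + 1)) (a : Fin n →₀ ℕ) :
    ((a.prod fun j e => w j ^ e) - a.prod fun j e => v j ^ e) ∈ orderIdeal n (d + a.degree) := by
  induction a using exponent_induction with
  | zero => simp
  | add a i ih =>
    rw [prod_pow_add_single, prod_pow_add_single, map_add, Finsupp.degree_single]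
    have h := add_mem (mul_mem_orderIdeal ih (hw i))
      (orderIdeal_anti (by lia) (mul_mem_orderIdeal (prod_pow_mem hv a) (hd i)) :
        _ ∈ orderIdeal n (d + a.degree + 1))
    rw [← add_assoc]
    convert h using 1
    ring

theorem subst_mem {w : Fin n → MvPowerSeries (Fin n) ℂ} {k : ℕ} (hw : ∀ i, w i ∈ orderIdeal n 1)
    {f : MvPowerSeries (Fin n) ℂ} (hf : f ∈ orderIdeal n k) : subst w f ∈ orderIdeal n k := by
  intro e he
  rw [coeff_subst (hasSubst_of_mem hw)]
  refine finsum_eq_zero_of_forall_eq_zero fun a => ?_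
  rcases lt_or_ge a.degree k with h | h
  · rw [hf a h, zero_smul]
  · rw [prod_pow_mem hw a e (by lia), smul_zero]

theorem subst_sub_mem {w v : Fin n → MvPowerSeries (Fin n) ℂ} {d k : ℕ}
    (hw : ∀ i, w i ∈ orderIdeal n 1) (hv : ∀ i, v i ∈ orderIdeal n 1)
    (hd : ∀ i, w i - v i ∈ orderIdeal n (d + 1)) {f : MvPowerSeries (Fin n) ℂ}
    (hf : f ∈ orderIdeal n k) : subst w f - subst v f ∈ orderIdeal n (d + k) := by
  intro e he
  rw [map_sub, sub_eq_zero, coeff_subst (hasSubst_of_mem hw), coeff_subst (hasSubst_of_mem hv)]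
  refine finsum_congr fun a => ?_
  rcases lt_or_ge a.degree k with h | h
  · rw [hf a h, zero_smul, zero_smul]
  · have := prod_pow_sub_mem hw hv hd a e (by lia)
    rw [map_sub, sub_eq_zero] at this
    rw [this]

theorem X_add_mem {u : Fin n → MvPowerSeries (Fin n) ℂ} (hu : ∀ i, u i ∈ orderIdeal n 2)
    (i : Fin n) : X i + u i ∈ orderIdeal n 1 :=
  add_mem (X_mem_orderIdeal i) (orderIdeal_anti one_le_two (hu i))

/-- The inverse function theorem for convergent maps tangent to the identity. The inverse `x + v`
is characterised by `v = - u (x + v)`. -/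
theorem exists_inverse {u : Fin n → MvPowerSeries (Fin n) ℂ} (hu : ∀ i, u i ∈ orderIdeal n 2)
    (huc : ∀ i, IsConvergent (u i)) :
    ∃ v : Fin n → MvPowerSeries (Fin n) ℂ, (∀ i, v i ∈ orderIdeal n 2) ∧
      (∀ i, IsConvergent (v i)) ∧ ∀ i, subst (fun j => X j + v j) (X i + u i) = X i := by
  have hev : ∀ᶠ R in 𝓝[>] (0 : ℝ≥0), ∀ i, wnorm R (u i) ≤ ((1 / 2 : ℝ≥0) : ℝ≥0∞) * R ^ 1 :=
    eventually_all.mpr fun i => eventually_wnorm_le (huc i) (hu i) (by positivity)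
  obtain ⟨R, hR, hR0⟩ := (hev.and self_mem_nhdsWithin).exists
  have hR0 : 0 < R := hR0
  obtain ⟨v, hv, hvN, hfix⟩ : ∃ v : Fin n → MvPowerSeries (Fin n) ℂ,
      (∀ i, v i ∈ orderIdeal n 2) ∧ (∀ i, wnorm (R / 2) (v i) ≤ ((R / 2 : ℝ≥0) : ℝ≥0∞)) ∧
        (fun i => - subst (fun j => X j + v j) (u i)) = v := by
    refine exists_fixedPoint (T := fun v i => - subst (fun j => X j + v j) (u i)) ?_ ?_ ?_
    · intro v hv i
      exact neg_mem (subst_mem (X_add_mem hv) (hu i))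
    · intro w v d hw hv hd hwv i
      obtain ⟨d, rfl⟩ := Nat.exists_eq_add_of_le' (one_le_two.trans hd)
      rw [neg_sub_neg, ← neg_sub]
      refine neg_mem (subst_sub_mem (k := 2) (X_add_mem hw) (X_add_mem hv) (fun j => ?_) (hu i))
      rw [add_sub_add_left_eq_sub]
      exact hwv j
    · intro v hv hvN i
      change wnorm _ (- subst (fun j => X j + v j) (u i)) ≤ _
      rw [wnorm_neg]
      refine (wnorm_subst_le (R := R) (hasSubst_of_mem (X_add_mem hv)) (fun j => ?_) (u i)).trans
        ((hR i).trans (le_of_eq ?_))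
      · refine (wnorm_add_le _ _ _).trans ?_
        rw [wnorm_X]
        refine (add_le_add_right (hvN j) _).trans ?_
        rw [← ENNReal.coe_add, add_halves]
      · rw [pow_one, ← ENNReal.coe_mul, one_div_mul_eq_div]
  refine ⟨v, hv, fun i => isConvergent_iff.mpr
    ⟨R / 2, by positivity, ((hvN i).trans_lt ENNReal.coe_lt_top).ne⟩, fun i => ?_⟩
  have hs := hasSubst_of_mem (X_add_mem hv)
  have h1 : - subst (fun j => X j + v j) (u i) = v i := congrFun hfix i
  rw [subst_add hs, subst_X hs, ← h1]
  ring

theorem isConvergent_X_add {u : Fin n → MvPowerSeries (Fin n) ℂ} (huc : ∀ i, IsConvergent (u i))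
    (i : Fin n) : IsConvergent (X i + u i) := by
  have h := isConvergent_coe (MvPolynomial.X (R := ℂ) i)
  rw [MvPolynomial.coe_X] at h
  exact h.add (huc i)

theorem isConvergent_subst {u : Fin n → MvPowerSeries (Fin n) ℂ} (hu : ∀ i, u i ∈ orderIdeal n 2)
    (huc : ∀ i, IsConvergent (u i)) {f : MvPowerSeries (Fin n) ℂ} (hf : IsConvergent f) :
    IsConvergent (subst (fun j => X j + u j) f) := by
  obtain ⟨R, hR, hfR⟩ := isConvergent_iff.mp hf
  have hev : ∀ᶠ r in 𝓝[>] (0 : ℝ≥0), ∀ i, wnorm r (X i + u i) ≤ (R : ℝ≥0∞) * r ^ 0 :=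
    eventually_all.mpr fun i => eventually_wnorm_le (isConvergent_X_add huc i) (X_add_mem hu i) hR
  obtain ⟨r, hr, hr0⟩ := (hev.and self_mem_nhdsWithin).exists
  refine isConvergent_iff.mpr ⟨r, hr0, ne_top_of_le_ne_top hfR
    (wnorm_subst_le (hasSubst_of_mem (X_add_mem hu)) (fun i => ?_) f)⟩
  simpa using hr i

/-- The substitution `x ↦ x + u` as an endomorphism of the ring of convergent power series. -/
noncomputable def substHom (u : Fin n → MvPowerSeries (Fin n) ℂ) (hu : ∀ i, u i ∈ orderIdeal n 2)
    (huc : ∀ i, IsConvergent (u i)) : O n →ₐ[ℂ] O n :=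
  ((substAlgHom (R := ℂ) (hasSubst_of_mem (X_add_mem hu))).comp (O n).val).codRestrict (O n)
    fun f => by
      rw [AlgHom.comp_apply, substAlgHom_apply]
      exact isConvergent_subst hu huc f.2

theorem coe_substHom_apply {u : Fin n → MvPowerSeries (Fin n) ℂ} (hu : ∀ i, u i ∈ orderIdeal n 2)
    (huc : ∀ i, IsConvergent (u i)) (f : O n) :
    (substHom u hu huc f : MvPowerSeries (Fin n) ℂ) =
      subst (fun j => X j + u j) (f : MvPowerSeries (Fin n) ℂ) := by
  change substAlgHom (R := ℂ) (hasSubst_of_mem (X_add_mem hu)) _ = _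
  rw [substAlgHom_apply]
  rfl

theorem exists_substHom_leftInverse {u : Fin n → MvPowerSeries (Fin n) ℂ}
    (hu : ∀ i, u i ∈ orderIdeal n 2) (huc : ∀ i, IsConvergent (u i)) :
    ∃ (v : Fin n → MvPowerSeries (Fin n) ℂ) (hv : ∀ i, v i ∈ orderIdeal n 2)
      (hvc : ∀ i, IsConvergent (v i)), ∀ f, substHom v hv hvc (substHom u hu huc f) = f := by
  obtain ⟨v, hv, hvc, h⟩ := exists_inverse hu huc
  refine ⟨v, hv, hvc, fun f => Subtype.ext ?_⟩
  rw [coe_substHom_apply, coe_substHom_apply,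
    subst_comp_subst_apply (hasSubst_of_mem (X_add_mem hu)) (hasSubst_of_mem (X_add_mem hv)),
    funext h]
  exact congrFun subst_self _

/-- Substitutions tangent to the identity are automorphisms: a left inverse is a substitution of
the same kind, so it has a left inverse itself. -/
theorem bijective_substHom {u : Fin n → MvPowerSeries (Fin n) ℂ}
    (hu : ∀ i, u i ∈ orderIdeal n 2) (huc : ∀ i, IsConvergent (u i)) :
    Function.Bijective (substHom u hu huc) := by
  obtain ⟨v, hv, hvc, h⟩ := exists_substHom_leftInverse hu huc
  obtain ⟨w, hw, hwc, h'⟩ := exists_substHom_leftInverse hv hvc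
  refine ⟨Function.LeftInverse.injective h, fun f => ⟨substHom v hv hvc f, ?_⟩⟩
  exact Function.LeftInverse.injective h' (h _)

end Substitution

/-! ### Determinacy -/

theorem mem_orderIdeal_of_mem_maxIdeal_pow {k : ℕ} {f : O n} (hf : f ∈ maxIdeal n ^ k) :
    (f : MvPowerSeries (Fin n) ℂ) ∈ orderIdeal n k := by
  have hle : ∀ k, maxIdeal n ^ k ≤ (orderIdeal n k).comap (O n).val := by
    intro k
    induction k with
    | zero => exact fun f _ a ha => absurd ha (Nat.not_lt_zero _)
    | succ k ih =>
      rw [pow_succ, Ideal.mul_le]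
      intro f hf g hg
      refine mul_mem_orderIdeal (ih hf) fun a ha => ?_
      have : a = 0 := (Finsupp.degree_eq_zero_iff a).mp (by lia)
      rw [this]
      exact hg
  exact hle k hf

/-- Determinacy in terms of orders: adding terms of order greater than `n * (m - 2)` to a regular
form of degree `m` does not change its right equivalence class. The condition on `(n - 1) * (m - 2)`
makes the resulting substitution tangent to the identity. -/
theorem IsRegularHomogeneous.rightEquivalent {m : ℕ} (hm : 2 ≤ m) (hs : 2 ≤ (n - 1) * (m - 2))
    {f : MvPolynomial (Fin n) ℂ} (hf : IsRegularHomogeneous f m) {g : O n}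
    (hg : ((g - ofPoly f : O n) : MvPowerSeries (Fin n) ℂ) ∈ orderIdeal n (n * (m - 2) + 1)) :
    RightEquivalent (ofPoly f) g := by
  obtain ⟨m, rfl⟩ := Nat.exists_eq_add_of_le' hm
  simp only [Nat.add_sub_cancel] at hs hg
  -- the degree `n * (m - 2) + 1` splits as `(n - 1) * (m - 2)` plus the degree of the derivatives
  have hk : n * m + 1 = (n - 1) * m + (m + 1) := by
    cases n with
    | zero => simp at hs
    | succ n => rw [Nat.add_sub_cancel]; ring
  rw [hk] at hg
  obtain ⟨u, hu, huc, h⟩ := exists_aeval_add_eq (e := m + 1) hs hf.homogeneous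
    (fun p hp => hf.exists_sum_mul_pderiv hm (by simp; lia) hp) hg (g - ofPoly f).2
  have hu2 : ∀ i, u i ∈ orderIdeal n 2 := fun i => orderIdeal_anti hs (hu i)
  refine ⟨AlgEquiv.ofBijective _ (bijective_substHom hu2 huc), Subtype.ext ?_⟩
  rw [AlgEquiv.coe_ofBijective, coe_substHom_apply]
  change subst _ (f : MvPowerSeries (Fin n) ℂ) = _
  rw [subst_coe, h]
  simp [ofPoly]

theorem RightEquivalent.germsEquivalent {f g : O n} (h : RightEquivalent f g) :
    GermsEquivalent f g := by
  obtain ⟨φ, rfl⟩ := h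
  exact ⟨φ, by rw [Ideal.map_span, Set.image_singleton]⟩

end Series

end ConvergentSeries

theorem theorem3p1 (n m : ℕ) (hn : 2 ≤ n) (hm : 3 ≤ m) (hnm : (n, m) ≠ (2, 3)) :
    (∀ f : MvPolynomial (Fin n) ℂ, ConvergentSeries.IsRegularHomogeneous f m →
      ConvergentSeries.IsRightDetermined (n * (m - 2)) (ConvergentSeries.ofPoly f)) ∧
    IsLeast (ConvergentSeries.determinacyBounds n m) (ConvergentSeries.D n m) ∧
    ConvergentSeries.D n m ≤ n * (m - 2) + 1 ∧
    ((n = 3 ∧ m = 3) ∨ (n = 2 ∧ m = 4) → ConvergentSeries.D n m = m + 1) := by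
  have hs : 2 ≤ (n - 1) * (m - 2) := by
    obtain ⟨a, rfl⟩ := Nat.exists_eq_add_of_le' hn
    obtain ⟨b, rfl⟩ := Nat.exists_eq_add_of_le' hm
    have hab : a ≠ 0 ∨ b ≠ 0 := by
      by_contra! h
      exact hnm (by simp [h])
    simp only [show a + 2 - 1 = a + 1 from rfl, show b + 3 - 2 = b + 1 from rfl]
    rcases hab with h | h <;> nlinarith [Nat.pos_of_ne_zero h, Nat.zero_le (a * b)]
  have hmem : n * (m - 2) + 1 ∈ ConvergentSeries.determinacyBounds n m := by
    refine ⟨?_, fun f hf d hd g hg => ?_⟩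
    · obtain ⟨a, rfl⟩ := Nat.exists_eq_add_of_le' hn
      obtain ⟨b, rfl⟩ := Nat.exists_eq_add_of_le' hm
      simp only [show a + 2 - 1 = a + 1 from rfl, show b + 3 - 2 = b + 1 from rfl] at hs ⊢
      nlinarith
    · exact (hf.rightEquivalent (by lia) hs (ConvergentSeries.orderIdeal_anti hd
        (ConvergentSeries.mem_orderIdeal_iff_le_order.mpr hg))).germsEquivalent
  have hle : ConvergentSeries.D n m ≤ n * (m - 2) + 1 := Nat.sInf_le hmem
  have hD : ConvergentSeries.D n m ∈ ConvergentSeries.determinacyBounds n m :=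
    Nat.sInf_mem ⟨_, hmem⟩
  refine ⟨fun f hf g hg => ?_, ⟨hD, fun k hk => Nat.sInf_le hk⟩, hle, fun h => ?_⟩
  · refine hf.rightEquivalent (by lia) hs (ConvergentSeries.mem_orderIdeal_of_mem_maxIdeal_pow ?_)
    exact Ideal.Quotient.eq.mp hg.symm
  · refine le_antisymm (hle.trans ?_) hD.1
    rcases h with ⟨rfl, rfl⟩ | ⟨rfl, rfl⟩ <;> norm_num
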